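/- Let $\mathcal D_2$ be the Dyck inverse monoid with zero, generated by $\alpha_-(n),\alpha_+(n)$, $n\in\{0,1\}$, with relations $\alpha_-(n)\alpha_+(n)=\mathbf 1$ and $\alpha_-(n)\alpha_+(m)=0$ for $n\ne m$; let $\mathcal D_2^-$ and $\mathcal D_2^+$ be the subsemigroups generated by the $\alpha_-(n)$ and by the $\alpha_+(n)$. Consider the directed graph with vertices $0,1$ and edges $\beta^-(0):0\to0$, $\beta^-:0\to1$, $\beta^-(1):1\to0$, $\beta^+(0):0\to0$, $\beta^+:1\to0$, $\beta^+(1):0\to1$, with labels $\lambda(\beta^\pm(n))=\alpha_\pm(n)$ and $\lambda(\beta^-)=\lambda(\beta^+)=\mathbf 1$, and extend $\lambda$ multiplicatively to paths. The Fibonacci-Dyck shift $F$ is the subshift whose points are the bi-infinite sequences of edges all of whose finite subwords are directed paths $b$ with $\lambda(b)\neq0$. A multiplier is a primitive word in the symbols $\alpha(0),\alpha(1)$, taken up to cyclic permutation; $\mathcal M$ is the set of multipliers. A periodic point $p\in F$ of least period $n$, and its orbit, have multiplier $\mu_-$ (respectively $\mu_+$) if for some $i\in\mathbb Z$, some representative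 $\alpha(n_1)\cdots\alpha(n_J)$ of $\mu$ and some $\kappa\ge1$ the product $\lambda(p_i\cdots p_{i+n-1})$ equals $(\alpha_-(n_1)\cdots\alpha_-(n_J))^\kappa$ (respectively $(\alpha_+(n_J)\cdots\alpha_+(n_1))^\kappa$); they have negative (positive) multiplier if for some $i$ this product lies in $\mathcal D_2^-$ ($\mathcal D_2^+$). Let $\mathcal O_n(\mu_\pm)$ and $\mathcal O_n^\pm$ denote the sets of orbits of length $n$ with multiplier $\mu_\pm$, respectively with negative/positive multiplier. A multiplier $\mu$ is exceptional if for some $n\ge1$ $$\operatorname{card}\big(\mathcal O_n(\mu_-)\cup\mathcal O_n(\mu_+)\big)>\max\{\operatorname{card}\mathcal O_n^-,\operatorname{card}\mathcal O_n^+\}.$$ **Lemma 2.** The exceptional multipliers of the Fibonacci-Dyck shift are exactly $\alpha(0)$ and $\alpha(1)$. Moreover, for every multiplier $\mu\notin\{\alpha(0),\alpha(1)\}$ and every $n\ge1$, $$\operatorname{card}\mathcal O_n(\mu_-)\le\operatorname{card}\Big(\bigcup_{\tilde\mu\in\mathcal M\setminus\{\mu\}}\mathcal O_n(\tilde\mu_-)\Big).$$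 -/

import Mathlib

/-- The Dyck inverse monoid `𝒟_N` (polycyclic monoid with zero), in normal form. Besides `0`, its
elements are `word p q`, which stands for
`α₊(p₁) ⋯ α₊(p_k) · α₋(q_l) ⋯ α₋(q₁)`: the negative part is listed from right to left. -/
inductive Dyck (N : ℕ) : Type
  | zero : Dyck N
  | word (p q : List (Fin N)) : Dyck N
  deriving DecidableEq

namespace Dyck

variable {N : ℕ}

instance : Zero (Dyck N) := ⟨zero⟩

instance : One (Dyck N) := ⟨word [] []⟩

/-- Multiplication of normal forms: with `q = q₁ ⋯ q_l` and `r = r₁ ⋯ r_k`, the product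
`α₋(q_l) ⋯ α₋(q₁) · α₊(r₁) ⋯ α₊(r_k)` cancels from the inside; it is nonzero exactly if one of
`q`, `r` is a prefix of the other. -/
protected def mul : Dyck N → Dyck N → Dyck N
  | zero, _ => zero
  | word _ _, zero => zero
  | word p q, word r s =>
    if q <+: r then word (p ++ r.drop q.length) s
    else if r <+: q then word p (s ++ q.drop r.length)
    else zero

instance : Mul (Dyck N) := ⟨Dyck.mul⟩

theorem word_mul_word (p q r s : List (Fin N)) : word p q * word r s =
    if q <+: r then word (p ++ r.drop q.length) s
    else if r <+: q then word p (s ++ q.drop r.length)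
    else zero := rfl

/-- The action of `𝒟_N` on words by partial injections; only used to prove associativity. -/
def act : Dyck N → List (Fin N) → Option (List (Fin N))
  | zero, _ => none
  | word p q, t => if q <+: t then some (p ++ t.drop q.length) else none

theorem act_append (p q t : List (Fin N)) : act (word p q) (q ++ t) = some (p ++ t) := by
  simp [act]

theorem act_eq_some {p q t u : List (Fin N)} (h : act (word p q) t = some u) :
    ∃ v, t = q ++ v ∧ u = p ++ v := by
  simp only [act] at h
  split_ifs at h with h1
  obtain ⟨v, rfl⟩ := h1
  exact ⟨v, rfl, by simpa using h.symm⟩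

theorem act_mul (x y : Dyck N) (t : List (Fin N)) :
    act (x * y) t = (act y t).bind (act x) := by
  change act (Dyck.mul x y) t = _
  rcases x with _ | ⟨p, q⟩ <;> rcases y with _ | ⟨r, s⟩
  · rfl
  · simp only [Dyck.mul, act]
    split_ifs <;> rfl
  · rfl
  · simp only [Dyck.mul]
    by_cases hs : s <+: t
    · obtain ⟨t, rfl⟩ := hs
      rw [act_append, Option.bind_some]
      split_ifs with h1 h2
      · obtain ⟨r, rfl⟩ := h1
        simp [act]
      · obtain ⟨q, rfl⟩ := h2
        simp [act, List.prefix_append_right_inj, List.drop_append, List.drop_eq_nil_of_le]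
      · have : ¬ q <+: r ++ t := fun h => by
          rcases List.prefix_or_prefix_of_prefix h (List.prefix_append r t) with h | h
          · exact h1 h
          · exact h2 h
        simp [act, this]
    · have e : act (word r s) t = none := by simp [act, hs]
      rw [e, Option.bind_none]
      split_ifs with h1 h2
      · simp [act, hs]
      · have : ¬ s ++ q.drop r.length <+: t := fun h => hs ((List.prefix_append _ _).trans h)
        simp [act, this]
      · rfl

theorem act_injective {x y : Dyck N} (h : act x = act y) : x = y := by
  rcases x with _ | ⟨p, q⟩ <;> rcases y with _ | ⟨r, s⟩
  · rfl
  · have := congrFun h s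
    simp [act] at this
  · have := congrFun h q
    simp [act] at this
  · have h1 : act (word r s) q = some p := by rw [← h]; simp [act]
    have h2 : act (word p q) s = some r := by rw [h]; simp [act]
    obtain ⟨v, rfl, rfl⟩ := act_eq_some h1
    obtain ⟨w, hw, -⟩ := act_eq_some h2
    have : v = [] := by
      have := congrArg List.length hw
      simp only [List.length_append] at this
      exact List.eq_nil_of_length_eq_zero (by omega)
    simp [this]

instance : MonoidWithZero (Dyck N) where
  mul_assoc x y z := act_injective <| funext fun t => by
    simp only [act_mul, Option.bind_assoc]
  one_mul x := act_injective <| funext fun t => by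
    have : act (1 : Dyck N) = some := funext fun t => by
      change act (word [] []) t = _
      simp [act]
    rw [act_mul, this]
    cases act x t <;> rfl
  mul_one x := act_injective <| funext fun t => by
    have : act (1 : Dyck N) t = some t := by
      change act (word [] []) t = _
      simp [act]
    rw [act_mul, this, Option.bind_some]
  zero_mul x := act_injective <| funext fun t => by
    rw [act_mul]
    cases act x t <;> rfl
  mul_zero x := act_injective <| funext fun t => by
    rw [act_mul]
    rfl

/-- The generator `α₋(n)`. -/
def neg (n : Fin N) : Dyck N := word [] [n]

/-- The generator `α₊(n)`. -/
def pos (n : Fin N) : Dyck N := word [n] []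

/-- The defining relations. -/
theorem neg_mul_pos (n m : Fin N) : neg n * pos m = if n = m then 1 else 0 := by
  by_cases h : n = m
  · subst h; simp [neg, pos, word_mul_word]; rfl
  · simp [neg, pos, word_mul_word, h, Ne.symm h]; rfl

/-- Every normal form is the product of generators that it stands for. -/
theorem word_eq (p q : List (Fin N)) :
    word p q = (p.map pos).prod * (q.reverse.map neg).prod := by
  have h1 : ∀ p : List (Fin N), (p.map pos).prod = word p [] := by
    intro p
    induction p with
    | nil => rfl
    | cons a p ih => simp [ih, pos, word_mul_word]
  have h2 : ∀ q : List (Fin N), (q.reverse.map neg).prod = word [] q := by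
    intro q
    induction q with
    | nil => rfl
    | cons a q ih =>
      rw [List.reverse_cons, List.map_append, List.prod_append, ih, List.map_singleton,
        List.prod_singleton, neg, word_mul_word]
      cases q <;> simp
  rw [h1, h2, word_mul_word]
  simp

/-- `α₋(n₁) ⋯ α₋(n_J)` for the word `n₁ ⋯ n_J`. -/
def negWord (w : List (Fin N)) : Dyck N := (w.map neg).prod

/-- `α₊(n_J) ⋯ α₊(n₁)` for the word `n₁ ⋯ n_J`. -/
def posWord (w : List (Fin N)) : Dyck N := (w.reverse.map pos).prod

/-- The semigroup `𝒟_N⁻` generated by the `α₋(n)` (it does not contain `1`). -/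
def negPart (N : ℕ) : Set (Dyck N) := {x | ∃ w : List (Fin N), w ≠ [] ∧ x = negWord w}

/-- The semigroup `𝒟_N⁺` generated by the `α₊(n)` (it does not contain `1`). -/
def posPart (N : ℕ) : Set (Dyck N) := {x | ∃ w : List (Fin N), w ≠ [] ∧ x = posWord w}

end Dyck

/-- A word is primitive if it is nonempty and not a power of another word. -/
def IsPrimitiveWord {A : Type*} (w : List A) : Prop :=
  w ≠ [] ∧ ∀ (v : List A) (k : ℕ), w = (List.replicate k v).flatten → k = 1

/-- Multipliers: primitive words in the symbols `α(n)`, `0 ≤ n < N`, up to cyclic permutation. -/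
def Multiplier (N : ℕ) : Type :=
  {c : Cycle (Fin N) // ∃ w : List (Fin N), IsPrimitiveWord w ∧ c = (w : Cycle (Fin N))}

namespace Multiplier

variable {N : ℕ}

/-- The word `w` is a representative of the multiplier `μ`. -/
def IsRep (μ : Multiplier N) (w : List (Fin N)) : Prop := (w : Cycle (Fin N)) = μ.1

/-- The multiplier `α(n)`. -/
def single (n : Fin N) : Multiplier N :=
  ⟨([n] : List (Fin N)), [n], ⟨by simp, fun v k h => by
    have := congrArg List.length h
    simp only [List.length_singleton, List.length_flatten, List.map_replicate,
      List.sum_replicate, smul_eq_mul] at this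
    exact Nat.eq_one_of_mul_eq_one_right this.symm⟩, rfl⟩

end Multiplier

/-- A directed graph with vertices `V`, edges `E`, and edges labelled in `𝒟_N`. -/
structure DyckGraph (N : ℕ) (V E : Type) where
  src : E → V
  tgt : E → V
  label : E → Dyck N

/-- The word `x_i x_{i+1} ⋯ x_{i+n-1}`. -/
def window {E : Type} (x : ℤ → E) (i : ℤ) (n : ℕ) : List E :=
  (List.range n).map fun j : ℕ => x (i + (j : ℤ))

/-- The shift `(S x)_i = x_{i+1}`. -/
def shift {E : Type} (x : ℤ → E) : ℤ → E := fun i => x (i + 1)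

/-- The orbit of a point under all (positive and negative) powers of the shift. -/
def shiftOrbit {E : Type} (x : ℤ → E) : Set (ℤ → E) :=
  Set.range fun (k : ℤ) (i : ℤ) => x (i + k)

namespace DyckGraph

variable {N : ℕ} {V E : Type} (G : DyckGraph N V E)

/-- Directed paths, as words of edges. -/
def IsPath (b : List E) : Prop := b.IsChain fun e f => G.tgt e = G.src f

/-- The label `λ(b)` of a word of edges. -/
def pathLabel (b : List E) : Dyck N := (b.map G.label).prod

/-- The subshift whose admissible words are the directed paths `b` with `λ(b) ≠ 0`. -/
def subshift : Set (ℤ → E) :=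
  {x | ∀ (i : ℤ) (n : ℕ), G.IsPath (window x i n) ∧ G.pathLabel (window x i n) ≠ 0}

/-- Periodic points of the subshift with least period `n`. -/
def periodicPts (n : ℕ) : Set (ℤ → E) :=
  {p | p ∈ G.subshift ∧ 0 < n ∧ Function.minimalPeriod shift p = n}

/-- Points of least period `n` with multiplier `μ₋`: over some period block the label is a power
of `α₋(n₁) ⋯ α₋(n_J)` for a representative of `μ`. -/
def ptsNeg (n : ℕ) (μ : Multiplier N) : Set (ℤ → E) :=
  {p | p ∈ G.periodicPts n ∧ ∃ (i : ℤ) (w : List (Fin N)) (κ : ℕ), μ.IsRep w ∧ 0 < κ ∧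
    G.pathLabel (window p i n) = Dyck.negWord w ^ κ}

/-- Points of least period `n` with multiplier `μ₊`. -/
def ptsPos (n : ℕ) (μ : Multiplier N) : Set (ℤ → E) :=
  {p | p ∈ G.periodicPts n ∧ ∃ (i : ℤ) (w : List (Fin N)) (κ : ℕ), μ.IsRep w ∧ 0 < κ ∧
    G.pathLabel (window p i n) = Dyck.posWord w ^ κ}

/-- `𝒪_n(μ₋)`: the periodic orbits of length `n` with multiplier `μ₋`. -/
def orbitsNegOf (n : ℕ) (μ : Multiplier N) : Set (Set (ℤ → E)) := shiftOrbit '' G.ptsNeg n μ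

/-- `𝒪_n(μ₊)`: the periodic orbits of length `n` with multiplier `μ₊`. -/
def orbitsPosOf (n : ℕ) (μ : Multiplier N) : Set (Set (ℤ → E)) := shiftOrbit '' G.ptsPos n μ

/-- `𝒪_n⁻`: the periodic orbits of length `n` with negative multiplier. -/
def orbitsNeg (n : ℕ) : Set (Set (ℤ → E)) :=
  shiftOrbit '' {p | p ∈ G.periodicPts n ∧ ∃ i : ℤ, G.pathLabel (window p i n) ∈ Dyck.negPart N}

/-- `𝒪_n⁺`: the periodic orbits of length `n` with positive multiplier. -/
def orbitsPos (n : ℕ) : Set (Set (ℤ → E)) :=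
  shiftOrbit '' {p | p ∈ G.periodicPts n ∧ ∃ i : ℤ, G.pathLabel (window p i n) ∈ Dyck.posPart N}

/-- The multiplier `μ` is exceptional at period `n`. -/
def IsExceptionalAt (μ : Multiplier N) (n : ℕ) : Prop :=
  max (G.orbitsNeg n).encard (G.orbitsPos n).encard <
    (G.orbitsNegOf n μ ∪ G.orbitsPosOf n μ).encard

/-- The multiplier `μ` is exceptional (at some period `n ≥ 1`). -/
def IsExceptional (μ : Multiplier N) : Prop := ∃ n : ℕ, 0 < n ∧ G.IsExceptionalAt μ n

end DyckGraph

/-- The edges `β⁻(0), β⁻, β⁻(1), β⁺(0), β⁺, β⁺(1)`. -/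
inductive FibEdge : Type
  | neg0 | neg | neg1 | pos0 | pos | pos1
  deriving DecidableEq

/-- The labelled graph of the Fibonacci-Dyck shift: the Fibonacci graph `β⁻(0) : 0 → 0`,
`β⁻ : 0 → 1`, `β⁻(1) : 1 → 0`, together with its reversal. -/
def fibonacciDyck : DyckGraph 2 (Fin 2) FibEdge where
  src
    | .neg0 => 0
    | .neg => 0
    | .neg1 => 1
    | .pos0 => 0
    | .pos => 1
    | .pos1 => 0
  tgt
    | .neg0 => 0
    | .neg => 1
    | .neg1 => 0
    | .pos0 => 0
    | .pos => 0
    | .pos1 => 1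
  label
    | .neg0 => Dyck.neg 0
    | .neg => 1
    | .neg1 => Dyck.neg 1
    | .pos0 => Dyck.pos 0
    | .pos => 1
    | .pos1 => Dyck.pos 1

/-! Reversing time and exchanging signs maps the orbits with multiplier μ₊ to those with multiplier
μ₋ and keeps their lengths, so the union of the two sets has at most twice as many elements as
𝒪_n(μ₋). Hence μ is not exceptional once 𝒪_n⁻ contains, outside 𝒪_n(μ₋), at least as many orbits as
𝒪_n(μ₋) has. `exists_disjoint_orbits` finds them among the orbits of other multipliers, which is
also the claimed inequality.

Orbits are counted through well-placed period blocks: loops at vertex 0 that end in an edge with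
negative label and whose label is exactly α₋(v). Every orbit with negative multiplier has such a
block for each conjugate of its label (`exists_window_mem_negLoops`); if v is primitive, distinct
blocks give distinct orbits (`isRotated_of_orbitOf_eq`). Decomposing by the first edge
(`encard_negWalks`) shows that the number of blocks of length n depends only on the numbers i, j of
letters 0, 1 in v: it is the coefficient of z^n in z^(i+2j) T^(2i+3j), where T = 1 + z² T³.

Let w represent μ, with i, j ≥ 1. Its orbits come from the labels w^k. For k ≥ 2 the primitive word
0^(ki) 1^(kj) has equally many blocks and belongs to another multiplier. For k = 1 the relation
T^(r+1) = T^r + z² T^(r+3) bounds the count by those of at most three other words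
(`exists_loopCount_le_sum`). For α(0) at n = 1 and α(1) at n = 2 there is just one negative orbit
and at most one positive one, while the multiplier owns a distinct orbit of each sign. -/

namespace Dyck

/-! ### Cancellation in the Dyck monoid. -/

variable {N : ℕ}

theorem zero_ne_word (p q : List (Fin N)) : (zero : Dyck N) ≠ word p q := nofun

theorem negWord_eq_word (w : List (Fin N)) : negWord w = word [] w.reverse := by
  rw [word_eq]; simp [negWord]

theorem posWord_eq_word (w : List (Fin N)) : posWord w = word w.reverse [] := by
  rw [word_eq]; simp [posWord]

theorem negWord_append (v w : List (Fin N)) : negWord (v ++ w) = negWord v * negWord w := by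
  simp [negWord]

theorem negWord_nil : negWord ([] : List (Fin N)) = 1 := rfl

theorem negWord_pow (w : List (Fin N)) (k : ℕ) :
    negWord w ^ k = negWord (List.replicate k w).flatten := by
  induction k with
  | zero => rfl
  | succ k ih => rw [pow_succ', ih, List.replicate_succ, List.flatten_cons, negWord_append]

theorem negWord_injective : Function.Injective (negWord (N := N)) := fun v w h => by
  simpa [negWord_eq_word] using h

theorem negWord_ne_zero (w : List (Fin N)) : negWord w ≠ 0 := by
  rw [negWord_eq_word]; exact fun h => zero_ne_word _ _ h.symm

theorem pos_mul_eq_word_iff (m : Fin N) (x : Dyck N) (p q : List (Fin N)) :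
    pos m * x = word p q ↔ ∃ p', p = m :: p' ∧ x = word p' q := by
  rcases x with _ | ⟨r, s⟩
  · constructor
    · intro h; exact (zero_ne_word _ _ h).elim
    · rintro ⟨_, _, h⟩; exact (zero_ne_word _ _ h).elim
  · simp only [pos, word_mul_word, List.nil_prefix, if_true, List.length_nil, List.drop_zero,
      word.injEq, List.singleton_append]
    constructor
    · rintro ⟨rfl, rfl⟩; exact ⟨r, rfl, rfl, rfl⟩
    · rintro ⟨_, rfl, rfl, rfl⟩; exact ⟨rfl, rfl⟩

theorem neg_mul_eq_word_iff (m : Fin N) (x : Dyck N) (p v : List (Fin N)) :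
    neg m * x = word p v.reverse ↔
      x = word (m :: p) v.reverse ∨ p = [] ∧ ∃ v', v = m :: v' ∧ x = word [] v'.reverse := by
  rcases x with _ | ⟨r, s⟩
  · constructor
    · intro h; exact (zero_ne_word _ _ h).elim
    · rintro (h | ⟨_, _, _, h⟩) <;> exact (zero_ne_word _ _ h).elim
  · simp only [neg, word_mul_word]
    rcases r with _ | ⟨a, r⟩
    · simp only [List.prefix_nil, List.cons_ne_nil, if_false, List.nil_prefix, if_true,
        List.length_nil, List.drop_zero, word.injEq, reduceCtorEq, false_and, false_or, true_and]
      constructor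
      · rintro ⟨rfl, h⟩
        refine ⟨rfl, s.reverse, ?_, by simp⟩
        have := congrArg List.reverse h
        simpa using this.symm
      · rintro ⟨rfl, v', rfl, rfl⟩; simp
    · by_cases h : m = a
      · subst h
        simp
      · simp only [List.cons_prefix_cons, h, Ne.symm h, false_and, if_false, word.injEq,
          List.cons.injEq, reduceCtorEq, and_false, or_false, exists_false]

theorem mul_neg_eq_negWord_iff (m : Fin N) (x : Dyck N) (v : List (Fin N)) :
    x * neg m = negWord v ↔ ∃ v', v = v' ++ [m] ∧ x = negWord v' := by
  constructor
  · intro h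
    rw [negWord_eq_word] at h
    rcases x with _ | ⟨p, q⟩
    · exact (zero_ne_word _ _ h).elim
    · have h' : word p (m :: q) = word [] v.reverse := by
        rw [← h, neg, word_mul_word]
        cases q <;> simp
      simp only [word.injEq] at h'
      obtain ⟨rfl, h'⟩ := h'
      refine ⟨q.reverse, ?_, by simp [negWord_eq_word]⟩
      have := congrArg List.reverse h'
      simpa using this.symm
  · rintro ⟨v', rfl, rfl⟩
    rw [negWord_append]; simp [negWord]

/-- No positive letter survives in the product, so the final α₊(m) must cancel against a final α₋(m)
of `x`. -/
theorem eq_negWord_of_mul_pos (m : Fin N) (x : Dyck N) (v : List (Fin N))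
    (h : x * pos m = negWord v) : x = negWord (v ++ [m]) := by
  rw [negWord_eq_word] at h ⊢
  rcases x with _ | ⟨p, q⟩
  · exact (zero_ne_word _ _ h).elim
  · rw [pos, word_mul_word] at h
    rcases q with _ | ⟨a, q⟩
    · simp at h
    · by_cases e : a = m
      · subst e
        rcases q with _ | ⟨b, q⟩
        · simp at h; simp [h]
        · simp at h; simp [h]
      · simp [e, Ne.symm e] at h

/-- Multiplying on the right never removes positive letters from the left end of a normal form. -/
theorem eq_negWord_of_mul_eq {x y : Dyck N} {v : List (Fin N)} (h : x * y = negWord v) :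
    ∃ w, x = negWord w := by
  rw [negWord_eq_word] at h
  rcases x with _ | ⟨p, q⟩
  · exact (zero_ne_word _ _ h).elim
  rcases y with _ | ⟨r, s⟩
  · exact (zero_ne_word _ _ h).elim
  refine ⟨q.reverse, ?_⟩
  rw [word_mul_word] at h
  split_ifs at h
  · simp only [word.injEq, List.append_eq_nil_iff] at h
    simp [negWord_eq_word, h.1.1]
  · simp only [word.injEq] at h
    simp [negWord_eq_word, h.1]

/-- The anti-automorphism exchanging `α₋(n)` and `α₊(n)`. -/
def flip : Dyck N → Dyck N
  | zero => zero
  | word p q => word q p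

theorem flip_flip (x : Dyck N) : flip (flip x) = x := by cases x <;> rfl

theorem flip_mul (x y : Dyck N) : flip (x * y) = flip y * flip x := by
  rcases x with _ | ⟨p, q⟩ <;> rcases y with _ | ⟨r, s⟩ <;> try rfl
  simp only [flip, word_mul_word]
  by_cases h1 : q <+: r <;> by_cases h2 : r <+: q
  · have := h1.eq_of_length_le h2.length_le
    subst this
    simp
  all_goals simp [h1, h2]

theorem flip_prod (l : List (Dyck N)) : flip l.prod = (l.reverse.map flip).prod := by
  induction l with
  | nil => rfl
  | cons a l ih => simp [flip_mul, ih]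

theorem flip_ne_zero {x : Dyck N} (h : x ≠ 0) : flip x ≠ 0 := fun h' => h (by
  rw [← flip_flip x, h']; rfl)

theorem flip_negWord (w : List (Fin N)) : flip (negWord w) = posWord w := by
  rw [negWord_eq_word, posWord_eq_word]; rfl

theorem flip_pow (x : Dyck N) (k : ℕ) : flip (x ^ k) = flip x ^ k := by
  induction k with
  | zero => rfl
  | succ k ih => rw [pow_succ, flip_mul, ih, pow_succ']

end Dyck

/-! ### Conjugate, commuting and primitive words. -/

section Words

variable {A : Type*}

/-- Commuting words are powers of a common word. -/
theorem List.exists_replicate_of_append_comm (x y : List A) (h : x ++ y = y ++ x) :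
    ∃ (u : List A) (k l : ℕ),
      x = (List.replicate k u).flatten ∧ y = (List.replicate l u).flatten := by
  induction hn : x.length + y.length using Nat.strong_induction_on generalizing x y with
  | _ n ih =>
    subst hn
    wlog hle : x.length ≤ y.length generalizing x y
    · obtain ⟨u, k, l, hk, hl⟩ := this y x h.symm
        (fun m hm a b hab e => ih m (by omega) a b hab e) (by omega)
      exact ⟨u, l, k, hl, hk⟩
    by_cases hx : x = []
    · exact ⟨y, 0, 1, by simp [hx], by simp⟩
    -- Euclid's algorithm on lengths: the shorter word is stripped off the longer, and the remainder
    -- still commutes with it.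
    · have hp : x <+: y := List.prefix_of_prefix_length_le (l₃ := x ++ y)
        (List.prefix_append _ _) (h ▸ List.prefix_append _ _) hle
      obtain ⟨z, rfl⟩ := hp
      have hz : x ++ z = z ++ x := by simpa using h
      have : 0 < x.length := List.length_pos_iff.2 hx
      obtain ⟨u, k, l, hk, hl⟩ := ih (x.length + z.length) (by simp; omega) x z hz rfl
      refine ⟨u, k, k + l, hk, ?_⟩
      rw [List.replicate_add, List.flatten_append, ← hk, ← hl]

theorem IsPrimitiveWord.eq_nil_or_eq_nil {x y : List A} (hp : IsPrimitiveWord (x ++ y))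
    (h : x ++ y = y ++ x) : x = [] ∨ y = [] := by
  obtain ⟨u, k, l, hk, hl⟩ := List.exists_replicate_of_append_comm x y h
  have := hp.2 u (k + l) (by rw [List.replicate_add, List.flatten_append, ← hk, ← hl])
  rcases k with _ | k
  · left; simpa using hk
  · right
    have : l = 0 := by omega
    simpa [this] using hl

theorem flatten_replicate_append_comm (x y : List A) (k : ℕ) :
    (List.replicate k (x ++ y)).flatten ++ x = x ++ (List.replicate k (y ++ x)).flatten := by
  induction k with
  | zero => simp
  | succ k ih =>
    rw [List.replicate_succ, List.flatten_cons, List.append_assoc, ih]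
    simp [List.replicate_succ]

theorem isRotated_iff_append {v w : List A} :
    v ~r w ↔ ∃ x y, v = x ++ y ∧ w = y ++ x := by
  constructor
  · rintro h
    obtain ⟨k, hk, rfl⟩ := List.isRotated_iff_mod.1 h
    exact ⟨v.take k, v.drop k, by simp, List.rotate_eq_drop_append_take hk⟩
  · rintro ⟨x, y, rfl, rfl⟩
    exact List.isRotated_append

theorem isRotated_iff_append_ne_nil {v w : List A} (hv : v ≠ []) (h : v ~r w) :
    ∃ x y, x ≠ [] ∧ v = x ++ y ∧ w = y ++ x := by
  obtain ⟨x, y, rfl, rfl⟩ := isRotated_iff_append.1 h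
  by_cases hx : x = []
  · subst hx
    exact ⟨y, [], by simpa using hv, by simp, by simp⟩
  · exact ⟨x, y, hx, rfl, rfl⟩

theorem IsRotated.flatten_replicate {v w : List A} (h : v ~r w) (k : ℕ) :
    (List.replicate k v).flatten ~r (List.replicate k w).flatten := by
  obtain ⟨x, y, rfl, rfl⟩ := isRotated_iff_append.1 h
  rcases k with _ | k
  · rfl
  · refine isRotated_iff_append.2 ⟨x, y ++ (List.replicate k (x ++ y)).flatten, ?_, ?_⟩
    · simp [List.replicate_succ]
    · rw [List.append_assoc, flatten_replicate_append_comm]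
      simp [List.replicate_succ]

/-- Rotating by one letter turns (at)^k into (ta)^k, so being a k-th power is invariant under
conjugation. -/
theorem exists_eq_flatten_replicate_of_isRotated {v x : List A} {k : ℕ}
    (h : (List.replicate k x).flatten ~r v) : ∃ y, v = (List.replicate k y).flatten := by
  obtain ⟨n, rfl⟩ := h
  induction n with
  | zero => exact ⟨x, by simp⟩
  | succ n ih =>
    obtain ⟨y, hy⟩ := ih
    rw [← List.rotate_rotate, hy]
    rcases y with _ | ⟨a, t⟩
    · exact ⟨[], by simp⟩
    · rcases k with _ | k
      · exact ⟨[], by simp⟩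
      · refine ⟨t ++ [a], ?_⟩
        have := flatten_replicate_append_comm [a] t k
        simp only [List.singleton_append] at this
        rw [List.replicate_succ, List.flatten_cons, List.cons_append, List.rotate_cons_succ,
          List.rotate_zero, List.append_assoc, this]
        simp [List.replicate_succ]

theorem IsPrimitiveWord.eq_one_of_isRotated {v x : List A} {k : ℕ} (hv : IsPrimitiveWord v)
    (h : (List.replicate k x).flatten ~r v) : k = 1 := by
  obtain ⟨y, hy⟩ := exists_eq_flatten_replicate_of_isRotated h
  exact hv.2 y k hy

/-- The words `0 ⋯ 0 1 ⋯ 1` containing both letters are primitive. -/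
theorem isPrimitiveWord_sorted {I J : ℕ} (hI : 0 < I) (hJ : 0 < J) :
    IsPrimitiveWord (List.replicate I (0 : Fin 2) ++ List.replicate J 1) := by
  refine ⟨by simp; omega, fun x k h => ?_⟩
  have h0 : (0 : Fin 2) ∈ (List.replicate k x).flatten := by rw [← h]; simp; omega
  have h1 : (1 : Fin 2) ∈ (List.replicate k x).flatten := by rw [← h]; simp; omega
  have hs : ((List.replicate k x).flatten).Pairwise (· ≤ ·) := by
    rw [← h, List.pairwise_append]
    simp
  have m0 : (0 : Fin 2) ∈ x := by simp at h0; exact h0.2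
  have m1 : (1 : Fin 2) ∈ x := by simp at h1; exact h1.2
  rcases k with _ | _ | k
  · simp at h0
  · rfl
  -- With two or more copies of `x`, a 1 in the first copy would precede a 0 in a later one.
  · rw [List.replicate_succ, List.flatten_cons, List.pairwise_append] at hs
    have := hs.2.2 1 m1 0 (by simp [List.replicate_succ, m0])
    simp at this

end Words

/-! ### Counting walks with a prescribed label. -/

namespace FibDyck

open Dyck

/-- The coefficient of `s ^ m` in `T ^ r`, where `T = 1 + s * T ^ 3`. -/
def ternaryCoeff : ℕ → ℕ → ℕ
  | 0, _ => 1
  | _ + 1, 0 => 0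
  | m + 1, r + 1 => ternaryCoeff (m + 1) r + ternaryCoeff m (r + 3)
  termination_by m r => (m, r)

/-- The coefficient of `z ^ n` in `z ^ k * T ^ r`, where `T = 1 + z ^ 2 * T ^ 3`. -/
def walkCoeff (k r n : ℕ) : ℕ :=
  if k ≤ n ∧ 2 ∣ n - k then ternaryCoeff ((n - k) / 2) r else 0

/-- This is T^(r+1) = T^r + z² T^(r+3), multiplied by z^k. -/
theorem walkCoeff_succ (k r n : ℕ) :
    walkCoeff k (r + 1) n = walkCoeff k r n + walkCoeff (k + 2) (r + 3) n := by
  unfold walkCoeff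
  by_cases h : k ≤ n ∧ 2 ∣ n - k
  · obtain ⟨hk, m, hm⟩ := h
    obtain rfl : n = k + 2 * m := by omega
    rcases m with _ | m
    · simp [ternaryCoeff]
    · have e1 : k + 2 * (m + 1) - k = 2 * (m + 1) := by omega
      have e2 : k + 2 * (m + 1) - (k + 2) = 2 * m := by omega
      have e3 : k + 2 ≤ k + 2 * (m + 1) := by omega
      simp [e1, e2, e3, ternaryCoeff]
  · have h' : ¬ (k + 2 ≤ n ∧ 2 ∣ n - (k + 2)) := by omega
    simp [h, h']

theorem walkCoeff_mono (k n : ℕ) : Monotone fun r => walkCoeff k r n :=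
  monotone_nat_of_le_succ fun r => by
    rw [walkCoeff_succ]; exact Nat.le_add_right _ _

theorem walkCoeff_succ_succ (k r n : ℕ) : walkCoeff (k + 1) r (n + 1) = walkCoeff k r n := by
  simp [walkCoeff]

theorem walkCoeff_zero_right (k r : ℕ) : walkCoeff (k + 1) r 0 = 0 := by
  simp [walkCoeff]

theorem walkCoeff_zero_zero (n : ℕ) : walkCoeff 0 0 (n + 1) = 0 := by
  unfold walkCoeff
  split_ifs with h
  · obtain ⟨m, hm⟩ : ∃ m, (n + 1 - 0) / 2 = m + 1 := ⟨(n + 1 - 0) / 2 - 1, by omega⟩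
    rw [hm, ternaryCoeff]
  · rfl

theorem walkCoeff_eq_zero {k n : ℕ} (r : ℕ) (h : n < k) : walkCoeff k r n = 0 := by
  simp [walkCoeff, h]

/-- `Walk u b v`: the word `b` is a directed path from `u` to `v`. -/
def Walk : Fin 2 → List FibEdge → Fin 2 → Prop
  | u, [], v => u = v
  | u, e :: b, v => fibonacciDyck.src e = u ∧ Walk (fibonacciDyck.tgt e) b v

/-- Walks of length `n` from `u` to `0` with label `α₊(p₁) ⋯ α₊(p_k) α₋(v₁) ⋯ α₋(v_l)` that end
in an edge with negative label, if they are not empty. -/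
def negWalks (u : Fin 2) (p v : List (Fin 2)) (n : ℕ) : Set (List FibEdge) :=
  {b | b.length = n ∧ Walk u b 0 ∧ fibonacciDyck.pathLabel b = word p v.reverse ∧
    ∀ e ∈ b.getLast?, e = .neg0 ∨ e = .neg1}

/-- The least length of an element of `negWalks u p v`. -/
def cost : Fin 2 → List (Fin 2) → List (Fin 2) → ℕ
  | _, [], [] => 0
  | u, [], m :: v => (if u = m then 1 else 2) + cost 0 [] v
  | u, m :: p, v => (if u = 0 then 1 else 2) + cost m p v

theorem pathLabel_cons (e : FibEdge) (b : List FibEdge) :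
    fibonacciDyck.pathLabel (e :: b) = fibonacciDyck.label e * fibonacciDyck.pathLabel b := by
  simp [DyckGraph.pathLabel]

theorem pathLabel_append (b c : List FibEdge) : fibonacciDyck.pathLabel (b ++ c) =
    fibonacciDyck.pathLabel b * fibonacciDyck.pathLabel c := by
  simp [DyckGraph.pathLabel]

theorem pathLabel_nil : fibonacciDyck.pathLabel [] = 1 := rfl

theorem encard_eq_sum_cons (S : Set (List FibEdge)) (h : [] ∉ S) :
    S.encard = {b | .neg0 :: b ∈ S}.encard + {b | .neg :: b ∈ S}.encard +
      {b | .neg1 :: b ∈ S}.encard + {b | .pos0 :: b ∈ S}.encard + {b | .pos :: b ∈ S}.encard +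
      {b | .pos1 :: b ∈ S}.encard := by
  have hi : ∀ e : FibEdge, {b | e :: b ∈ S}.encard = (List.cons e '' {b | e :: b ∈ S}).encard :=
    fun e => ((List.cons_injective).encard_image _).symm
  have hS : S = List.cons .neg0 '' {b | .neg0 :: b ∈ S} ∪ List.cons .neg '' {b | .neg :: b ∈ S} ∪
      List.cons .neg1 '' {b | .neg1 :: b ∈ S} ∪ List.cons .pos0 '' {b | .pos0 :: b ∈ S} ∪
      List.cons .pos '' {b | .pos :: b ∈ S} ∪ List.cons .pos1 '' {b | .pos1 :: b ∈ S} := by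
    ext b
    rcases b with _ | ⟨e, b⟩
    · simp [h]
    · cases e <;> simp
  conv_lhs => rw [hS]
  rw [Set.encard_union_eq, Set.encard_union_eq, Set.encard_union_eq, Set.encard_union_eq,
    Set.encard_union_eq, ← hi, ← hi, ← hi, ← hi, ← hi, ← hi] <;>
  · rw [Set.disjoint_left]
    rintro b hb ⟨c, _, rfl⟩
    simp at hb

theorem nil_notMem_negWalks {u : Fin 2} {p v : List (Fin 2)} {n : ℕ} (hv : v ≠ []) :
    [] ∉ negWalks u p v n := by
  rintro ⟨-, -, h, -⟩
  have : word [] [] = word p v.reverse := h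
  rw [word.injEq] at this
  exact hv (List.reverse_eq_nil_iff.1 this.2.symm)

theorem cons_mem_negWalks {u : Fin 2} {p v : List (Fin 2)} {n : ℕ} (hv : v ≠ []) (e : FibEdge)
    (b : List FibEdge) : e :: b ∈ negWalks u p v (n + 1) ↔ fibonacciDyck.src e = u ∧
      b.length = n ∧ Walk (fibonacciDyck.tgt e) b 0 ∧
      fibonacciDyck.label e * fibonacciDyck.pathLabel b = word p v.reverse ∧
      ∀ f ∈ b.getLast?, f = .neg0 ∨ f = .neg1 := by
  simp only [negWalks, Set.mem_ofPred_eq, List.length_cons, add_left_inj, Walk, pathLabel_cons]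
  constructor
  · rintro ⟨h1, ⟨h2, h3⟩, h4, h5⟩
    refine ⟨h2, h1, h3, h4, fun f hf => h5 f ?_⟩
    rcases b with _ | ⟨g, b⟩
    · simp at hf
    · simpa using hf
  · rintro ⟨h2, h1, h3, h4, h5⟩
    refine ⟨h1, ⟨h2, h3⟩, h4, fun f hf => ?_⟩
    rcases b with _ | ⟨g, b⟩
    · obtain rfl : e = f := by simpa using hf
      rw [pathLabel_nil, mul_one] at h4
      have key : ∀ q, word q [] ≠ word p v.reverse := fun q h => by
        rw [word.injEq] at h
        exact hv (List.reverse_eq_nil_iff.1 h.2.symm)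
      cases e
      · exact Or.inl rfl
      · exact (key _ h4).elim
      · exact Or.inr rfl
      all_goals exact (key _ h4).elim
    · exact h5 f (by simpa using hf)

/-- The leading α₋(m) is either cancelled later, so the remaining walk has an additional positive
letter in front, or it survives as the first letter of `v`, which requires that no positive letters
precede it. -/
theorem tail_neg {u x : Fin 2} {e : FibEdge} {m : Fin 2} (hs : fibonacciDyck.src e = u)
    (ht : fibonacciDyck.tgt e = x) (hl : fibonacciDyck.label e = neg m) {p v : List (Fin 2)}
    {n : ℕ} (hv : v ≠ []) : {b | e :: b ∈ negWalks u p v (n + 1)} =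
      negWalks x (m :: p) v n ∪ {b | p = [] ∧ ∃ v', v = m :: v' ∧ b ∈ negWalks x [] v' n} := by
  ext b
  rw [Set.mem_ofPred_eq, cons_mem_negWalks hv, hl, neg_mul_eq_word_iff, hs, ht]
  simp only [negWalks, Set.mem_union, Set.mem_ofPred_eq]
  constructor
  · rintro ⟨-, h1, h2, h3 | ⟨rfl, v', rfl, h3⟩, h4⟩
    · exact Or.inl ⟨h1, h2, h3, h4⟩
    · exact Or.inr ⟨rfl, v', rfl, h1, h2, h3, h4⟩
  · rintro (⟨h1, h2, h3, h4⟩ | ⟨rfl, v', rfl, h1, h2, h3, h4⟩)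
    · exact ⟨trivial, h1, h2, Or.inl h3, h4⟩
    · exact ⟨trivial, h1, h2, Or.inr ⟨rfl, v', rfl, h3⟩, h4⟩

theorem tail_pos {u x : Fin 2} {e : FibEdge} {m : Fin 2} (hs : fibonacciDyck.src e = u)
    (ht : fibonacciDyck.tgt e = x) (hl : fibonacciDyck.label e = pos m) {p v : List (Fin 2)}
    {n : ℕ} (hv : v ≠ []) : {b | e :: b ∈ negWalks u p v (n + 1)} =
      {b | ∃ p', p = m :: p' ∧ b ∈ negWalks x p' v n} := by
  ext b
  rw [Set.mem_ofPred_eq, cons_mem_negWalks hv, hl, pos_mul_eq_word_iff, hs, ht]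
  simp only [negWalks, Set.mem_ofPred_eq]
  constructor
  · rintro ⟨-, h1, h2, ⟨p', rfl, h3⟩, h4⟩
    exact ⟨p', rfl, h1, h2, h3, h4⟩
  · rintro ⟨p', rfl, h1, h2, h3, h4⟩
    exact ⟨trivial, h1, h2, ⟨p', rfl, h3⟩, h4⟩

theorem tail_one {u x : Fin 2} {e : FibEdge} (hs : fibonacciDyck.src e = u)
    (ht : fibonacciDyck.tgt e = x) (hl : fibonacciDyck.label e = 1) {p v : List (Fin 2)}
    {n : ℕ} (hv : v ≠ []) : {b | e :: b ∈ negWalks u p v (n + 1)} = negWalks x p v n := by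
  ext b
  rw [Set.mem_ofPred_eq, cons_mem_negWalks hv, hl, one_mul, hs, ht]
  simp only [negWalks, Set.mem_ofPred_eq, true_and]

theorem tail_eq_empty {u : Fin 2} {e : FibEdge} (hs : fibonacciDyck.src e ≠ u)
    {p v : List (Fin 2)} {n : ℕ} (hv : v ≠ []) :
    {b | e :: b ∈ negWalks u p v (n + 1)} = ∅ := by
  ext b
  simp [cons_mem_negWalks hv, hs]

/-- A negative letter at the right end has nothing to its right to cancel with. This makes the
well-placed cuts of a periodic point rigid. -/
theorem eq_nil_of_pathLabel_eq_one {b : List FibEdge} (h : fibonacciDyck.pathLabel b = 1)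
    (hb : ∀ e ∈ b.getLast?, e = .neg0 ∨ e = .neg1) : b = [] := by
  rcases List.eq_nil_or_concat b with rfl | ⟨c, e, rfl⟩
  · rfl
  · have he := hb e (by simp)
    rw [List.concat_eq_append, pathLabel_append, ← negWord_nil] at h
    rcases he with rfl | rfl
    · obtain ⟨v', hv', -⟩ := (mul_neg_eq_negWord_iff 0 _ []).1
        (by simpa [fibonacciDyck, DyckGraph.pathLabel] using h)
      simp at hv'
    · obtain ⟨v', hv', -⟩ := (mul_neg_eq_negWord_iff 1 _ []).1
        (by simpa [fibonacciDyck, DyckGraph.pathLabel] using h)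
      simp at hv'

theorem encard_negWalks_nil (n : ℕ) : (negWalks 0 [] [] n).encard = walkCoeff 0 0 n := by
  have h : negWalks 0 [] [] n = {b | b = [] ∧ n = 0} := by
    ext b
    constructor
    · rintro ⟨h1, -, h3, h4⟩
      have := eq_nil_of_pathLabel_eq_one h3 h4
      subst this
      exact ⟨rfl, h1.symm⟩
    · rintro ⟨rfl, rfl⟩
      exact ⟨rfl, rfl, rfl, by simp⟩
  rw [h]
  rcases n with _ | n
  · simp [walkCoeff, ternaryCoeff]
  · simp [walkCoeff_zero_zero]

/-- The first-edge recursion when the next letter is one edge away: the last term is the edge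
supplying that letter, the others are the edges that raise the cost by one. -/
theorem walkCoeff_cost_one (k r n : ℕ) : walkCoeff (k + 1) (r + 2) (n + 1) =
    walkCoeff (k + 2) (r + 4) n + walkCoeff (k + 2) (r + 3) n + walkCoeff k r n := by
  rw [walkCoeff_succ_succ, walkCoeff_succ, walkCoeff_succ]
  ring

/-- The first-edge recursion when the next letter is two edges away: one edge raises the cost by
one, another lowers it by one. -/
theorem walkCoeff_cost_two (k r n : ℕ) : walkCoeff (k + 2) (r + 3) (n + 1) =
    walkCoeff (k + 3) (r + 5) n + walkCoeff (k + 1) (r + 2) n := by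
  rw [walkCoeff_succ_succ, walkCoeff_succ]
  ring

theorem disjoint_negWalks {u u' : Fin 2} {p p' v v' : List (Fin 2)} {n n' : ℕ}
    (h : p ≠ p' ∨ v ≠ v') : Disjoint (negWalks u p v n) (negWalks u' p' v' n') := by
  rw [Set.disjoint_left]
  rintro b ⟨-, -, h1, -⟩ ⟨-, -, h2, -⟩
  rw [h1] at h2
  simp at h2
  tauto

theorem encard_negWalks_zero_succ (p v : List (Fin 2)) (hv : v ≠ []) (n : ℕ) :
    (negWalks 0 p v (n + 1)).encard = (negWalks 0 (0 :: p) v n).encard +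
      {b | p = [] ∧ ∃ v', v = 0 :: v' ∧ b ∈ negWalks 0 [] v' n}.encard +
      (negWalks 1 p v n).encard + {b | ∃ p', p = 0 :: p' ∧ b ∈ negWalks 0 p' v n}.encard +
      {b | ∃ p', p = 1 :: p' ∧ b ∈ negWalks 1 p' v n}.encard := by
  rw [encard_eq_sum_cons _ (nil_notMem_negWalks hv), tail_neg (e := .neg0) (u := 0) (x := 0) rfl rfl rfl hv,
    tail_one (e := .neg) (u := 0) (x := 1) rfl rfl rfl hv, tail_eq_empty (e := .neg1) (by decide) hv,
    tail_pos (e := .pos0) (u := 0) (x := 0) rfl rfl rfl hv, tail_eq_empty (e := .pos) (by decide) hv,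
    tail_pos (e := .pos1) (u := 0) (x := 1) rfl rfl rfl hv, Set.encard_union_eq, Set.encard_empty]
  · ring
  · rw [Set.disjoint_left]
    rintro b h ⟨rfl, v', rfl, h'⟩
    exact Set.disjoint_left.1 (disjoint_negWalks (Or.inl (by simp))) h h'

theorem encard_negWalks_one_succ (p v : List (Fin 2)) (hv : v ≠ []) (n : ℕ) :
    (negWalks 1 p v (n + 1)).encard = (negWalks 0 (1 :: p) v n).encard +
      {b | p = [] ∧ ∃ v', v = 1 :: v' ∧ b ∈ negWalks 0 [] v' n}.encard +
      (negWalks 0 p v n).encard := by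
  rw [encard_eq_sum_cons _ (nil_notMem_negWalks hv), tail_eq_empty (e := .neg0) (by decide) hv,
    tail_eq_empty (e := .neg) (by decide) hv, tail_neg (e := .neg1) (u := 1) (x := 0) rfl rfl rfl hv,
    tail_eq_empty (e := .pos0) (by decide) hv, tail_one (e := .pos) (u := 1) (x := 0) rfl rfl rfl hv,
    tail_eq_empty (e := .pos1) (by decide) hv, Set.encard_union_eq, Set.encard_empty]
  · ring
  · rw [Set.disjoint_left]
    rintro b h ⟨rfl, v', rfl, h'⟩
    exact Set.disjoint_left.1 (disjoint_negWalks (Or.inl (by simp))) h h'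

theorem cost_pos (u : Fin 2) (p v : List (Fin 2)) (hv : v ≠ []) : ∃ k, cost u p v = k + 1 := by
  rcases p with _ | ⟨m, p⟩
  · rcases v with _ | ⟨m, v⟩
    · exact (hv rfl).elim
    · simp only [cost]; split_ifs
      · exact ⟨_, add_comm _ _⟩
      · exact ⟨1 + cost 0 [] v, by ring⟩
  · simp only [cost]; split_ifs
    · exact ⟨_, add_comm _ _⟩
    · exact ⟨1 + cost m p v, by ring⟩

/-- Only loops with `p = []` are wanted in the end, but removing the first edge changes both the
vertex and the pending positive letters, so the induction needs all `u` and `p`. In each case the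
recursion is one of the two identities `walkCoeff_cost_one`, `walkCoeff_cost_two`. -/
theorem encard_negWalks (n : ℕ) (u : Fin 2) (p v : List (Fin 2)) (hv : v ≠ []) :
    (negWalks u p v n).encard =
      walkCoeff (cost u p v) (cost u p v + p.length + v.length) n := by
  induction n generalizing u p v with
  | zero =>
    obtain ⟨k, hk⟩ := cost_pos u p v hv
    rw [hk, walkCoeff_zero_right, Nat.cast_zero, Set.encard_eq_zero, Set.eq_empty_iff_forall_notMem]
    intro b hb
    obtain rfl : b = [] := List.eq_nil_of_length_eq_zero hb.1
    exact nil_notMem_negWalks hv hb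
  | succ n ih =>
    have ih' : ∀ v', (negWalks 0 [] v' n).encard =
        walkCoeff (cost 0 [] v') (cost 0 [] v' + v'.length) n := fun v' => by
      by_cases h : v' = []
      · subst h; simpa [cost] using encard_negWalks_nil n
      · simpa using ih 0 [] v' h
    have hu : u = 0 ∨ u = 1 := by omega
    rcases p with _ | ⟨m, p⟩
    · obtain ⟨m, v, rfl⟩ := List.exists_cons_of_ne_nil hv
      have hm : m = 0 ∨ m = 1 := by omega
      have key1 := walkCoeff_cost_one (cost 0 [] v) (cost 0 [] v + v.length) n
      have key2 := walkCoeff_cost_two (cost 0 [] v) (cost 0 [] v + v.length) n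
      rcases hu with rfl | rfl <;> rcases hm with rfl | rfl <;>
        simp only [encard_negWalks_zero_succ _ _ hv, encard_negWalks_one_succ _ _ hv,
          ih _ _ _ hv] <;>
        simp [ih', cost] <;> norm_cast <;> ring_nf at key1 key2 ⊢ <;> omega
    · have hm : m = 0 ∨ m = 1 := by omega
      have key1 := walkCoeff_cost_one (cost m p v) (cost m p v + p.length + v.length) n
      have key2 := walkCoeff_cost_two (cost m p v) (cost m p v + p.length + v.length) n
      rcases hu with rfl | rfl <;> rcases hm with rfl | rfl <;>
        simp only [encard_negWalks_zero_succ _ _ hv, encard_negWalks_one_succ _ _ hv,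
          ih _ _ _ hv] <;>
        simp [ih _ _ _ hv, cost] <;> norm_cast <;> ring_nf at key1 key2 ⊢ <;> omega

theorem cost_eq (v : List (Fin 2)) : cost 0 [] v = v.count 0 + 2 * v.count 1 := by
  induction v with
  | nil => simp [cost]
  | cons m v ih =>
    have hm : m = 0 ∨ m = 1 := by omega
    rcases hm with rfl | rfl <;> simp [cost, ih] <;> ring

theorem length_eq_count (v : List (Fin 2)) : v.length = v.count 0 + v.count 1 := by
  induction v with
  | nil => rfl
  | cons m v ih =>
    have hm : m = 0 ∨ m = 1 := by omega
    rcases hm with rfl | rfl <;> simp [ih] <;> ring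

theorem encard_negLoops (n : ℕ) (v : List (Fin 2)) (hv : v ≠ []) :
    (negWalks 0 [] v n).encard = walkCoeff (v.count 0 + 2 * v.count 1)
      (2 * v.count 0 + 3 * v.count 1) n := by
  rw [encard_negWalks n 0 [] v hv, cost_eq, length_eq_count v, List.length_nil]
  congr 2
  ring

end FibDyck

/-! ### Periodic points and their well-placed period blocks. -/

namespace FibDyck

open Dyck

section Window

variable {E : Type} (x : ℤ → E)

theorem length_window (i : ℤ) (n : ℕ) : (window x i n).length = n := by simp [window]

theorem window_zero (i : ℤ) : window x i 0 = [] := rfl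

theorem window_add (i : ℤ) (m n : ℕ) :
    window x i (m + n) = window x i m ++ window x (i + m) n := by
  simp [window, List.range_add, add_assoc]

theorem window_one (i : ℤ) : window x i 1 = [x i] := by simp [window]

theorem window_succ (i : ℤ) (n : ℕ) : window x i (n + 1) = x i :: window x (i + 1) n := by
  rw [add_comm, window_add, window_one]; rfl

theorem iterate_shift (m : ℕ) : shift^[m] x = fun i => x (i + m) := by
  induction m with
  | zero => simp
  | succ m ih =>
    rw [Function.iterate_succ_apply', ih]
    funext i
    simp only [shift]
    congr 1
    push_cast
    ring

theorem isPeriodicPt_shift_iff (m : ℕ) :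
    Function.IsPeriodicPt shift m x ↔ Function.Periodic x (m : ℤ) := by
  rw [Function.IsPeriodicPt, Function.IsFixedPt, iterate_shift, funext_iff]
  rfl

variable {x} {n : ℕ}

theorem window_congr (hx : Function.Periodic x (n : ℤ)) (i : ℤ) (m : ℕ) :
    window x (i % n) m = window x i m := by
  unfold window
  refine List.map_congr_left fun j _ => ?_
  rw [Int.emod_def]
  have := hx.sub_zsmul_eq (i / n) (x := i + j)
  rw [← this]
  congr 1
  simp
  ring

theorem window_add_period (hx : Function.Periodic x (n : ℤ)) (i : ℤ) (m : ℕ) :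
    window x (i + n) m = window x i m := by
  rw [← window_congr hx, Int.add_emod_right, window_congr hx]

theorem window_mul (hx : Function.Periodic x (n : ℤ)) (i : ℤ) (k : ℕ) :
    window x i (k * n) = (List.replicate k (window x i n)).flatten := by
  induction k with
  | zero => simp [window_zero]
  | succ k ih =>
    rw [add_mul, one_mul, add_comm, window_add, window_add_period hx, ih, List.replicate_succ,
      List.flatten_cons]

/-- Splitting two overlapping period blocks. -/
theorem window_rotate (hx : Function.Periodic x (n : ℤ)) (i : ℤ) {k : ℕ} (hk : k ≤ n) :
    window x i n = window x i k ++ window x (i + k) (n - k) ∧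
      window x (i + k) n = window x (i + k) (n - k) ++ window x i k := by
  constructor
  · rw [← window_add, Nat.add_sub_cancel' hk]
  · conv_lhs => rw [← Nat.sub_add_cancel hk, window_add]
    rw [add_assoc, ← Nat.cast_add, Nat.add_sub_cancel' hk, window_add_period hx]

theorem mem_shiftOrbit_self (x : ℤ → E) : x ∈ shiftOrbit x := ⟨0, by simp⟩

theorem shiftOrbit_translate (x : ℤ → E) (k : ℤ) : shiftOrbit (fun i => x (i + k)) = shiftOrbit x := by
  ext y
  constructor
  · rintro ⟨l, rfl⟩
    exact ⟨l + k, by simp [add_assoc]⟩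
  · rintro ⟨l, rfl⟩
    exact ⟨l - k, by simp [add_assoc]⟩

theorem exists_translate_of_shiftOrbit_eq {x y : ℤ → E} (h : shiftOrbit x = shiftOrbit y) :
    ∃ k : ℤ, y = fun i => x (i + k) := by
  obtain ⟨k, hk⟩ := h ▸ mem_shiftOrbit_self y
  exact ⟨k, hk.symm⟩

theorem window_translate (x : ℤ → E) (k i : ℤ) (m : ℕ) :
    window (fun i => x (i + k)) i m = window x (i + k) m := by
  unfold window
  refine List.map_congr_left fun j _ => ?_
  simp only [add_right_comm]

end Window

/-- The bi-infinite repetition of the word `b`. -/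
def periodize (b : List FibEdge) (i : ℤ) : FibEdge := b.getD (i % b.length).toNat .neg0

theorem periodize_periodic (b : List FibEdge) :
    Function.Periodic (periodize b) (b.length : ℤ) := fun i => by
  simp [periodize]

theorem window_periodize (b : List FibEdge) : window (periodize b) 0 b.length = b := by
  apply List.ext_getElem
  · simp [length_window]
  · intro j h1 h2
    have : ((j : ℤ) % b.length).toNat = j := by
      rw [Int.emod_eq_of_lt (by omega) (by omega)]; simp
    simp [window, periodize, this, h2]

theorem periodize_window {x : ℤ → FibEdge} {n : ℕ} (hn : 0 < n)
    (hx : Function.Periodic x (n : ℤ)) (j : ℤ) :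
    periodize (window x j n) = fun i => x (i + j) := by
  funext i
  have h1 : 0 ≤ i % n := Int.emod_nonneg _ (by omega)
  have h2 : i % n < n := Int.emod_lt_of_pos _ (by omega)
  have h3 : (i % (n : ℤ)).toNat < (window x j n).length := by rw [length_window]; omega
  unfold periodize
  rw [length_window, List.getD_eq_getElem _ _ h3]
  simp only [window, List.getElem_map, List.getElem_range, Int.toNat_of_nonneg h1]
  rw [Int.emod_def]
  have := hx.sub_zsmul_eq (i / n) (x := i + j)
  rw [← this]
  congr 1
  simp
  ring

/-- Consecutive entries of `x` are consecutive edges. -/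
def IsBiinfinitePath (x : ℤ → FibEdge) : Prop :=
  ∀ i, fibonacciDyck.tgt (x i) = fibonacciDyck.src (x (i + 1))

theorem isBiinfinitePath_of_mem {x : ℤ → FibEdge} (hx : x ∈ fibonacciDyck.subshift) :
    IsBiinfinitePath x := fun i => by
  have := (hx i 2).1
  simpa [DyckGraph.IsPath, window_succ, window_zero] using this

theorem IsBiinfinitePath.isPath_window {x : ℤ → FibEdge} (hx : IsBiinfinitePath x) (i : ℤ)
    (n : ℕ) : fibonacciDyck.IsPath (window x i n) := by
  induction n generalizing i with
  | zero => simp [DyckGraph.IsPath, window_zero]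
  | succ n ih =>
    rcases n with _ | n
    · simp [DyckGraph.IsPath, window_one]
    · have := ih (i + 1)
      rw [window_succ] at this
      rw [window_succ, window_succ]
      exact List.IsChain.cons_cons (hx i) this

theorem IsBiinfinitePath.walk_window {x : ℤ → FibEdge} (hx : IsBiinfinitePath x) (i : ℤ)
    (n : ℕ) :
    Walk (fibonacciDyck.src (x i)) (window x i n) (fibonacciDyck.src (x (i + n))) := by
  induction n generalizing i with
  | zero => simp [Walk, window_zero]
  | succ n ih =>
    rw [window_succ]
    refine ⟨rfl, ?_⟩
    rw [hx i]
    have := ih (i + 1)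
    rwa [add_assoc, add_comm 1, ← Nat.cast_succ] at this

theorem of_walk_window {x : ℤ → FibEdge} {u v : Fin 2} {i : ℤ} {n : ℕ}
    (h : Walk u (window x i (n + 1)) v) : fibonacciDyck.src (x i) = u ∧
      (∀ j < n, fibonacciDyck.tgt (x (i + j)) = fibonacciDyck.src (x (i + j + 1))) ∧
      fibonacciDyck.tgt (x (i + n)) = v := by
  induction n generalizing i u with
  | zero =>
    rw [window_one] at h
    exact ⟨h.1, by simp, by simpa [Walk] using h.2⟩
  | succ n ih =>
    rw [window_succ] at h
    obtain ⟨h1, h2, h3⟩ := ih h.2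
    refine ⟨h.1, fun j hj => ?_, ?_⟩
    · rcases j with _ | j
      · simpa using h1.symm
      · have := h2 j (by omega)
        rw [show i + ((j + 1 : ℕ) : ℤ) = i + 1 + j by push_cast; ring]
        exact this
    · rw [← h3]; congr 2; push_cast; ring

theorem isBiinfinitePath_of_walk {x : ℤ → FibEdge} {n : ℕ} (hn : 0 < n)
    (hx : Function.Periodic x (n : ℤ)) {u : Fin 2} (h : Walk u (window x 0 n) u) :
    IsBiinfinitePath x := fun i => by
  obtain ⟨n, rfl⟩ := Nat.exists_eq_succ_of_ne_zero hn.ne'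
  obtain ⟨h1, h2, h3⟩ := of_walk_window h
  have e1 : 0 ≤ i % (n + 1 : ℕ) := Int.emod_nonneg _ (by omega)
  have e2 : i % (n + 1 : ℕ) < (n + 1 : ℕ) := Int.emod_lt_of_pos _ (by omega)
  obtain ⟨j, hj⟩ := Int.eq_ofNat_of_zero_le e1
  have hw := window_congr hx i 2
  simp only [window_succ, window_zero, List.cons.injEq, and_true] at hw
  rw [← hw.1, ← hw.2, hj]
  rw [hj] at e2
  by_cases hjn : j = n
  · subst hjn
    have : x (0 + (j + 1 : ℕ)) = x 0 := hx 0
    rw [zero_add] at this h3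
    push_cast at this
    rw [h3, this, h1]
  · simpa using h2 j (by omega)

theorem mem_subshift_of_negWord {x : ℤ → FibEdge} {n : ℕ} (hn : 0 < n)
    (hx : Function.Periodic x (n : ℤ)) (hp : IsBiinfinitePath x) {v : List (Fin 2)}
    (hv : fibonacciDyck.pathLabel (window x 0 n) = negWord v) : x ∈ fibonacciDyck.subshift := by
  refine fun i m => ⟨hp.isPath_window i m, fun h0 => ?_⟩
  have e1 : 0 ≤ i % n := Int.emod_nonneg _ (by omega)
  obtain ⟨j, hj⟩ := Int.eq_ofNat_of_zero_le e1
  rw [← window_congr hx, hj] at h0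
  have hl : ∀ k, fibonacciDyck.pathLabel (List.replicate k (window x 0 n)).flatten =
      negWord v ^ k := by
    intro k
    induction k with
    | zero => rfl
    | succ k ih => rw [List.replicate_succ, List.flatten_cons, pathLabel_append, ih, hv, pow_succ']
  -- With `j` reduced modulo `n`, the window of length `m` at `j` lies inside `j + m` consecutive
  -- periods, whose label is nonzero.
  have h1 := hl (j + m)
  have h2 : (j + m) * n = j + (m + ((j + m) * n - (j + m))) := by
    have : j + m ≤ (j + m) * n := Nat.le_mul_of_pos_right _ hn
    omega
  rw [← window_mul hx, h2, window_add, window_add, pathLabel_append, pathLabel_append, zero_add,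
    h0, zero_mul, mul_zero, negWord_pow] at h1
  exact negWord_ne_zero _ h1.symm

theorem mem_negLoops_iff {v : List (Fin 2)} {n : ℕ} {b : List FibEdge} :
    b ∈ negWalks 0 [] v n ↔ b.length = n ∧ Walk 0 b 0 ∧
      fibonacciDyck.pathLabel b = negWord v ∧ ∀ e ∈ b.getLast?, e = .neg0 ∨ e = .neg1 := by
  rw [negWord_eq_word]; rfl

theorem pos_of_mem_negLoops {v : List (Fin 2)} {n : ℕ} {b : List FibEdge} (hv : v ≠ [])
    (hb : b ∈ negWalks 0 [] v n) : 0 < n := by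
  rcases Nat.eq_zero_or_pos n with rfl | h
  · obtain rfl : b = [] := List.eq_nil_of_length_eq_zero hb.1
    exact (nil_notMem_negWalks hv hb).elim
  · exact h

/-- Two period blocks in `negWalks 0 []` have conjugate labels. -/
theorem exists_append_of_window_mem {x : ℤ → FibEdge} {n k : ℕ}
    (hx : Function.Periodic x (n : ℤ)) (hk : k ≤ n) {i : ℤ} {v w : List (Fin 2)}
    (h1 : window x i n ∈ negWalks 0 [] v n) (h2 : window x (i + k) n ∈ negWalks 0 [] w n) :
    ∃ q r, v = q ++ r ∧ w = r ++ q ∧ (q = [] → k = 0) ∧ (r = [] → k = n) := by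
  obtain ⟨e1, e2⟩ := window_rotate hx i hk
  rw [e1, mem_negLoops_iff, pathLabel_append] at h1
  rw [e2, mem_negLoops_iff, pathLabel_append] at h2
  obtain ⟨-, -, l1, g1⟩ := h1
  obtain ⟨-, -, l2, g2⟩ := h2
  obtain ⟨q, hq⟩ := eq_negWord_of_mul_eq l1
  obtain ⟨r, hr⟩ := eq_negWord_of_mul_eq l2
  rw [hq, hr, ← negWord_append] at l1 l2
  have suff : ∀ {b c : List FibEdge}, (∀ e ∈ (b ++ c).getLast?, e = .neg0 ∨ e = .neg1) →
      ∀ e ∈ c.getLast?, e = .neg0 ∨ e = .neg1 := fun h e he => h e (by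
    simp only [Option.mem_def] at he ⊢
    rw [List.getLast?_append, he]; rfl)
  refine ⟨q, r, (negWord_injective l1).symm, (negWord_injective l2).symm, ?_, ?_⟩
  · rintro rfl
    have := congrArg List.length (eq_nil_of_pathLabel_eq_one hq (suff g2))
    simpa [length_window] using this
  · rintro rfl
    have := congrArg List.length (eq_nil_of_pathLabel_eq_one hr (suff g1))
    simp only [length_window, List.length_nil] at this
    omega

theorem pathLabel_singleton (e : FibEdge) :
    fibonacciDyck.pathLabel [e] = fibonacciDyck.label e := by
  simp [DyckGraph.pathLabel]

/-- A word with negative label splits according to any factorization of the label. -/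
theorem exists_split_of_pathLabel (b : List FibEdge) (v w : List (Fin 2)) (hv : v ≠ [])
    (h : fibonacciDyck.pathLabel b = negWord (v ++ w)) : ∃ c d, b = c ++ d ∧ c ≠ [] ∧
      fibonacciDyck.pathLabel c = negWord v ∧ fibonacciDyck.pathLabel d = negWord w ∧
      ∀ e ∈ c.getLast?, e = .neg0 ∨ e = .neg1 := by
  induction b using List.reverseRecOn generalizing w with
  | nil =>
    have := negWord_injective (negWord_nil.trans h)
    simp [hv] at this
  | append_singleton b e ih =>
    rw [pathLabel_append, pathLabel_singleton] at h
    have one : fibonacciDyck.label e = 1 → ∃ c d, b ++ [e] = c ++ d ∧ c ≠ [] ∧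
        fibonacciDyck.pathLabel c = negWord v ∧ fibonacciDyck.pathLabel d = negWord w ∧
        ∀ e ∈ c.getLast?, e = .neg0 ∨ e = .neg1 := fun he => by
      rw [he, mul_one] at h
      obtain ⟨c, d, rfl, h1, h2, h3, h4⟩ := ih w h
      exact ⟨c, d ++ [e], by simp, h1, h2,
        by rw [pathLabel_append, pathLabel_singleton, he, mul_one, h3], h4⟩
    have neg : ∀ m, fibonacciDyck.label e = neg m → (e = .neg0 ∨ e = .neg1) →
        ∃ c d, b ++ [e] = c ++ d ∧ c ≠ [] ∧
        fibonacciDyck.pathLabel c = negWord v ∧ fibonacciDyck.pathLabel d = negWord w ∧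
        ∀ e ∈ c.getLast?, e = .neg0 ∨ e = .neg1 := fun m he hn => by
      have h' := h
      rw [he, mul_neg_eq_negWord_iff] at h'
      obtain ⟨v', h1, h2⟩ := h'
      rcases List.eq_nil_or_concat w with rfl | ⟨w', m', rfl⟩
      · refine ⟨b ++ [e], [], by simp, by simp, ?_, rfl, by simpa using hn⟩
        rw [pathLabel_append, pathLabel_singleton, h, List.append_nil]
      · rw [List.concat_eq_append, ← List.append_assoc] at h1
        obtain ⟨h3, h4⟩ := List.append_inj' h1 rfl
        subst h3
        obtain ⟨c, d, rfl, g1, g2, g3, g4⟩ := ih w' h2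
        refine ⟨c, d ++ [e], by simp, g1, g2, ?_, g4⟩
        rw [pathLabel_append, pathLabel_singleton, he, g3, List.concat_eq_append, h4,
          negWord_append]
        simp [negWord]
    -- Before the final α₊(m) the label is longer by the letter m, hence the induction over all `w`.
    have pos : ∀ m, fibonacciDyck.label e = pos m → ∃ c d, b ++ [e] = c ++ d ∧ c ≠ [] ∧
        fibonacciDyck.pathLabel c = negWord v ∧ fibonacciDyck.pathLabel d = negWord w ∧
        ∀ e ∈ c.getLast?, e = .neg0 ∨ e = .neg1 := fun m he => by
      rw [he] at h
      have h' := eq_negWord_of_mul_pos _ _ _ h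
      rw [List.append_assoc] at h'
      obtain ⟨c, d, rfl, g1, g2, g3, g4⟩ := ih _ h'
      refine ⟨c, d ++ [e], by simp, g1, g2, ?_, g4⟩
      rw [pathLabel_append, pathLabel_singleton, he, g3, negWord_append, mul_assoc]
      simp [negWord, neg_mul_pos]
    cases e
    · exact neg 0 rfl (Or.inl rfl)
    · exact one rfl
    · exact neg 1 rfl (Or.inr rfl)
    · exact pos 0 rfl
    · exact one rfl
    · exact pos 1 rfl

theorem periodic_of_mem_periodicPts {p : ℤ → FibEdge} {n : ℕ}
    (hp : p ∈ fibonacciDyck.periodicPts n) : Function.Periodic p (n : ℤ) := by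
  rw [← isPeriodicPt_shift_iff, ← hp.2.2]
  exact Function.isPeriodicPt_minimalPeriod _ _

/-- Write v = xy and w = yx with x nonempty. The block splits into pieces labelled x and y, the
first ending in a negative edge; starting the period after that piece gives the required block. -/
theorem exists_window_mem_negLoops {p : ℤ → FibEdge} {n : ℕ}
    (hp : p ∈ fibonacciDyck.periodicPts n) {i : ℤ} {v w : List (Fin 2)} (hv : v ≠ [])
    (h : fibonacciDyck.pathLabel (window p i n) = negWord v) (hw : v ~r w) :
    ∃ j, window p j n ∈ negWalks 0 [] w n := by
  obtain ⟨x, y, hx, rfl, rfl⟩ := isRotated_iff_append_ne_nil hv hw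
  obtain ⟨c, d, hcd, hc, h1, h2, h3⟩ := exists_split_of_pathLabel _ _ _ hx h
  have hper := periodic_of_mem_periodicPts hp
  have hlen : c.length ≤ n := by
    rw [← length_window p i n, hcd]; simp
  obtain ⟨e1, e2⟩ := window_rotate hper i hlen
  obtain ⟨hc', hd'⟩ := List.append_inj (hcd.symm.trans e1) (by simp [length_window])
  rw [← hc', ← hd'] at e2
  have hpath := isBiinfinitePath_of_mem hp.1
  obtain ⟨k, hk⟩ := Nat.exists_eq_succ_of_ne_zero (mt List.length_eq_zero_iff.1 hc)
  have hlast : p (i + k) = .neg0 ∨ p (i + k) = .neg1 := h3 _ (by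
    rw [hc', hk, Nat.succ_eq_add_one, window_add, window_one]; simp)
  -- Both edges with negative label end at vertex 0.
  have hsrc : fibonacciDyck.src (p (i + c.length)) = 0 := by
    rw [hk, Nat.cast_succ, ← add_assoc, ← hpath]
    rcases hlast with h | h <;> rw [h] <;> rfl
  refine ⟨i + c.length, mem_negLoops_iff.2 ⟨length_window _ _ _, ?_, ?_, ?_⟩⟩
  · have := hpath.walk_window (i + c.length) n
    rwa [hper (i + c.length), hsrc] at this
  · rw [e2, pathLabel_append, h1, h2, negWord_append]
  · rw [e2, List.getLast?_append_of_ne_nil _ hc]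
    exact h3

/-- The orbit of the bi-infinite repetition of `b`. -/
def orbitOf (b : List FibEdge) : Set (ℤ → FibEdge) := shiftOrbit (periodize b)

theorem orbitOf_window {x : ℤ → FibEdge} {n : ℕ} (hn : 0 < n)
    (hx : Function.Periodic x (n : ℤ)) (j : ℤ) : orbitOf (window x j n) = shiftOrbit x := by
  rw [orbitOf, periodize_window hn hx, shiftOrbit_translate]

theorem window_periodize_of_mem {v : List (Fin 2)} {n : ℕ} {b : List FibEdge}
    (hb : b ∈ negWalks 0 [] v n) :
    Function.Periodic (periodize b) (n : ℤ) ∧ window (periodize b) 0 n = b := by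
  obtain rfl := hb.1
  exact ⟨periodize_periodic b, window_periodize b⟩

theorem periodize_mem_periodicPts {v : List (Fin 2)} {n : ℕ} {b : List FibEdge}
    (hv : IsPrimitiveWord v) (hb : b ∈ negWalks 0 [] v n) :
    periodize b ∈ fibonacciDyck.periodicPts n := by
  obtain ⟨hper, hwin⟩ := window_periodize_of_mem hb
  have hn := pos_of_mem_negLoops hv.1 hb
  have hpath : IsBiinfinitePath (periodize b) :=
    isBiinfinitePath_of_walk hn hper (u := 0) (by rw [hwin]; exact hb.2.1)
  refine ⟨mem_subshift_of_negWord hn hper hpath (v := v) ?_, hn, ?_⟩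
  · rw [hwin]; exact (mem_negLoops_iff.1 hb).2.2.1
  · have hp : Function.IsPeriodicPt shift n (periodize b) := (isPeriodicPt_shift_iff _ _).2 hper
    have hm := hp.minimalPeriod_le hn
    have hm0 := hp.minimalPeriod_pos hn
    have hk := (isPeriodicPt_shift_iff _ _).1 (Function.isPeriodicPt_minimalPeriod shift
      (periodize b))
    generalize Function.minimalPeriod shift (periodize b) = k at hm hm0 hk ⊢
    -- Shifting by the least period `k` reproduces the block, so v = qr = rq; primitivity leaves
    -- only the trivial cuts.
    obtain ⟨q, r, h1, h2, h3, h4⟩ := exists_append_of_window_mem (v := v) (w := v) hper hm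
      (i := 0) (by rwa [hwin]) (by rw [window_add_period hk]; rwa [hwin])
    rcases IsPrimitiveWord.eq_nil_or_eq_nil (h1 ▸ hv) (h1.symm.trans h2) with h | h
    · have := h3 h; omega
    · exact h4 h

/-- Both blocks are windows of one periodic point, so their labels are qr and rq. If these agree and
are primitive, q or r is empty, and rigidity of the cuts makes the windows coincide. -/
theorem isRotated_of_orbitOf_eq {v w : List (Fin 2)} {n : ℕ} {b c : List FibEdge}
    (hv : v ≠ []) (hb : b ∈ negWalks 0 [] v n) (hc : c ∈ negWalks 0 [] w n)
    (h : orbitOf b = orbitOf c) : v ~r w ∧ (v = w → IsPrimitiveWord v → b = c) := by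
  have hn := pos_of_mem_negLoops hv hb
  obtain ⟨hbper, hbwin⟩ := window_periodize_of_mem hb
  obtain ⟨hcper, hcwin⟩ := window_periodize_of_mem hc
  obtain ⟨k, hk⟩ := exists_translate_of_shiftOrbit_eq h
  have e0 : 0 ≤ k % n := Int.emod_nonneg _ (by omega)
  have e1 : k % n < n := Int.emod_lt_of_pos _ (by omega)
  obtain ⟨j, hj⟩ := Int.eq_ofNat_of_zero_le e0
  have hwin : window (periodize b) (0 + j) n = c := by
    rw [zero_add, ← hj, window_congr hbper]
    conv_rhs => rw [← hcwin, hk, window_translate, zero_add]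
  obtain ⟨q, r, h1, h2, h3, h4⟩ := exists_append_of_window_mem (v := v) (w := w) hbper
    (k := j) (i := 0) (by omega) (by rwa [hbwin]) (by rwa [hwin])
  refine ⟨isRotated_iff_append.2 ⟨q, r, h1, h2⟩, fun hvw hprim => ?_⟩
  subst hvw
  have hj0 : j = 0 := by
    rcases IsPrimitiveWord.eq_nil_or_eq_nil (h1 ▸ hprim) (h1.symm.trans h2) with h | h
    · exact h3 h
    · have := h4 h; omega
  rw [← hwin, ← hbwin, hj0]
  simp [hbwin]

end FibDyck

/-! ### Comparing the orbits of one multiplier with those of others. -/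

namespace FibDyck

open Dyck

/-- The number of negative loops of length `n` with `I` unmatched letters `0` and `J` unmatched
letters `1` in a fixed order. -/
def loopCount (x : ℕ × ℕ) (n : ℕ) : ℕ := walkCoeff (x.1 + 2 * x.2) (2 * x.1 + 3 * x.2) n

/-- The word `0 ⋯ 0 1 ⋯ 1`. -/
def sortedWord (x : ℕ × ℕ) : List (Fin 2) := List.replicate x.1 0 ++ List.replicate x.2 1

/-- The letter counts for which `sortedWord` is primitive. -/
def IsGood (x : ℕ × ℕ) : Prop := (0 < x.1 ∧ 0 < x.2) ∨ x = (1, 0) ∨ x = (0, 1)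

theorem isPrimitiveWord_singleton {A : Type*} (a : A) : IsPrimitiveWord [a] :=
  ⟨by simp, fun v k h => by
    have := congrArg List.length h
    simp only [List.length_singleton, List.length_flatten, List.map_replicate,
      List.sum_replicate, smul_eq_mul] at this
    exact Nat.eq_one_of_mul_eq_one_right this.symm⟩

theorem IsGood.isPrimitiveWord {x : ℕ × ℕ} (hx : IsGood x) : IsPrimitiveWord (sortedWord x) := by
  rcases hx with ⟨h0, h1⟩ | rfl | rfl
  · exact isPrimitiveWord_sorted h0 h1
  · exact isPrimitiveWord_singleton 0
  · exact isPrimitiveWord_singleton 1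

theorem count_sortedWord (x : ℕ × ℕ) :
    (sortedWord x).count 0 = x.1 ∧ (sortedWord x).count 1 = x.2 := by
  simp [sortedWord, List.count_replicate]

theorem encard_negLoops_eq_loopCount (n : ℕ) {v : List (Fin 2)} (hv : v ≠ []) :
    (negWalks 0 [] v n).encard = loopCount (v.count 0, v.count 1) n :=
  encard_negLoops n v hv

/-- Trading one letter 1 for two letters 0 keeps the power of z and raises the power of T by one,
which settles j ≥ 2. For j = 1 that would lead to a non-primitive power of 0, so T^(r+1) is expanded
instead. All multiples of (i, j) are avoided because they are reserved for the powers w^k. -/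
theorem exists_loopCount_le_sum {i j : ℕ} (hi : 0 < i) (hj : 0 < j) (n : ℕ) :
    ∃ s : Finset (ℕ × ℕ), (∀ x ∈ s, IsGood x ∧ ∀ k : ℕ, 0 < k → x ≠ (k * i, k * j)) ∧
      loopCount (i, j) n ≤ ∑ x ∈ s, loopCount x n := by
  have mono : ∀ {k r r' : ℕ}, r ≤ r' → walkCoeff k r n ≤ walkCoeff k r' n :=
    fun {k _ _} h => walkCoeff_mono k n h
  rcases (show j = 1 ∨ 2 ≤ j by omega) with rfl | hj2
  · rcases (show i = 1 ∨ i = 2 ∨ 3 ≤ i by omega) with rfl | rfl | hi3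
    -- z³T⁵ = z³T⁴ + z⁵T⁷, where z³T⁴ is part of zT² and z⁵T⁷ is at most z⁵T⁹.
    · refine ⟨{(1, 0), (3, 1)}, ?_, ?_⟩
      · simp only [Finset.mem_insert, Finset.mem_singleton, IsGood]
        rintro x (rfl | rfl) <;> simp <;> omega
      · rw [Finset.sum_pair (by simp)]
        simp only [loopCount]
        have h1 := walkCoeff_succ 3 4 n
        have h2 := walkCoeff_succ 1 1 n
        have h3 : walkCoeff 5 7 n ≤ walkCoeff 5 9 n := mono (by norm_num)
        norm_num at *
        omega
    -- z⁴T⁷ = z⁴T⁵ + z⁶T⁸ + z⁶T⁹, bounded termwise by z²T³, z⁶T¹⁰ and z⁶T¹¹.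
    · refine ⟨{(0, 1), (4, 1), (2, 2)}, ?_, ?_⟩
      · simp only [Finset.mem_insert, Finset.mem_singleton, IsGood]
        rintro x (rfl | rfl | rfl) <;> simp <;> omega
      · rw [Finset.sum_insert (by simp), Finset.sum_pair (by simp)]
        simp only [loopCount]
        have h1 := walkCoeff_succ 4 6 n
        have h2 := walkCoeff_succ 4 5 n
        have h3 := walkCoeff_succ 2 2 n
        have h4 : walkCoeff 6 9 n ≤ walkCoeff 6 11 n := mono (by norm_num)
        have h5 : walkCoeff 6 8 n ≤ walkCoeff 6 10 n := mono (by norm_num)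
        norm_num at *
        omega
    · obtain ⟨i, rfl⟩ : ∃ l, i = l + 3 := ⟨i - 3, by omega⟩
      -- Trading two letters 0 for a 1 lowers the power of T by one; the missing z² T^(r+3) is
      -- covered by the second pair.
      refine ⟨{(i + 1, 2), (i + 5, 1)}, ?_, ?_⟩
      · simp only [Finset.mem_insert, Finset.mem_singleton, IsGood]
        rintro x (rfl | rfl)
        · refine ⟨by simp, fun k hk h => ?_⟩
          simp only [Prod.mk.injEq] at h
          obtain rfl : k = 2 := by omega
          omega
        · refine ⟨by simp, fun k hk h => ?_⟩
          simp only [Prod.mk.injEq] at h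
          obtain rfl : k = 1 := by omega
          omega
      · rw [Finset.sum_pair (by simp)]
        simp only [loopCount]
        have h1 := walkCoeff_succ (i + 5) (2 * i + 8) n
        have h2 : walkCoeff (i + 7) (2 * i + 11) n ≤ walkCoeff (i + 7) (2 * i + 13) n :=
          mono (by omega)
        ring_nf at h1 h2 ⊢
        omega
  · obtain ⟨j, rfl⟩ : ∃ l, j = l + 2 := ⟨j - 2, by omega⟩
    refine ⟨{(i + 2, j + 1)}, ?_, ?_⟩
    · simp only [Finset.mem_singleton, IsGood]
      rintro x rfl
      refine ⟨by simp, fun k hk h => ?_⟩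
      simp only [Prod.mk.injEq] at h
      have := Nat.le_mul_of_pos_left (j + 2) hk
      omega
    · rw [Finset.sum_singleton]
      simp only [loopCount]
      rw [show i + 2 + 2 * (j + 1) = i + 2 * (j + 2) by ring]
      exact mono (by omega)

theorem sum_loopCount_le {i j : ℕ} (hi : 0 < i) (hj : 0 < j) (n : ℕ) :
    ∃ s : Finset (ℕ × ℕ), (∀ x ∈ s, IsGood x ∧ x ≠ (i, j)) ∧
      ∑ k ∈ Finset.Icc 1 n, loopCount (k * i, k * j) n ≤ ∑ x ∈ s, loopCount x n := by
  obtain ⟨s, hs, hle⟩ := exists_loopCount_le_sum hi hj n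
  have hinj : Function.Injective fun k : ℕ => (k * i, k * j) := fun k l h => by
    simp only [Prod.mk.injEq] at h
    exact Nat.eq_of_mul_eq_mul_right hi h.1
  -- `s` pays for k = 1; each k ≥ 2 is paid for by the primitive sorted word with the same letter
  -- counts.
  refine ⟨s ∪ (Finset.Icc 2 n).image fun k => (k * i, k * j), fun x hx => ?_, ?_⟩
  · rcases Finset.mem_union.1 hx with h | h
    · exact ⟨(hs x h).1, by simpa using (hs x h).2 1 one_pos⟩
    · obtain ⟨k, hk, rfl⟩ := Finset.mem_image.1 h
      rw [Finset.mem_Icc] at hk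
      refine ⟨Or.inl ⟨by simp; omega, by simp; omega⟩, fun h => ?_⟩
      have := hinj (a₁ := k) (a₂ := 1) (by simpa using h)
      omega
  · rw [Finset.sum_union, Finset.sum_image fun _ _ _ _ h => hinj h]
    · rcases Nat.eq_zero_or_pos n with rfl | hn
      · simp
      · rw [← Finset.insert_Icc_add_one_left_eq_Icc hn, Finset.sum_insert (by simp)]
        simpa using hle
    · rw [Finset.disjoint_left]
      intro x hx hx'
      obtain ⟨k, hk, rfl⟩ := Finset.mem_image.1 hx'
      rw [Finset.mem_Icc] at hk
      exact (hs _ hx).2 k (by omega) rfl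

theorem encard_biUnion_le {ι α : Type*} (s : Finset ι) (f : ι → Set α) :
    (⋃ i ∈ s, f i).encard ≤ ∑ i ∈ s, (f i).encard := by
  classical
  induction s using Finset.induction_on with
  | empty => simp
  | insert a s ha ih =>
    rw [Finset.set_biUnion_insert, Finset.sum_insert ha]
    exact (Set.encard_union_le _ _).trans (by gcongr)

theorem encard_biUnion_eq {ι α : Type*} (s : Finset ι) (f : ι → Set α)
    (h : Pairwise fun i j => Disjoint (f i) (f j)) :
    (⋃ i ∈ s, f i).encard = ∑ i ∈ s, (f i).encard := by
  classical
  induction s using Finset.induction_on with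
  | empty => simp
  | insert a s ha ih =>
    rw [Finset.set_biUnion_insert, Finset.sum_insert ha, Set.encard_union_eq, ih]
    simp only [Set.disjoint_iUnion_right]
    exact fun i hi => h (by rintro rfl; exact ha hi)

theorem sortedWord_injective : Function.Injective sortedWord := fun x y h => by
  have hx := count_sortedWord x
  have hy := count_sortedWord y
  rw [h] at hx
  exact Prod.ext (hx.1.symm.trans hy.1) (hx.2.symm.trans hy.2)

/-- The multiplier represented by a primitive word. -/
def multiplierOf {v : List (Fin 2)} (hv : IsPrimitiveWord v) : Multiplier 2 :=
  ⟨(v : Cycle (Fin 2)), v, hv, rfl⟩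

theorem orbitOf_mem_orbitsNegOf {v : List (Fin 2)} (hv : IsPrimitiveWord v) {n : ℕ}
    {b : List FibEdge} (hb : b ∈ negWalks 0 [] v n) :
    orbitOf b ∈ fibonacciDyck.orbitsNegOf n (multiplierOf hv) := by
  refine ⟨periodize b, ⟨periodize_mem_periodicPts hv hb, 0, v, 1, rfl, one_pos, ?_⟩, rfl⟩
  rw [(window_periodize_of_mem hb).2, pow_one]
  exact (mem_negLoops_iff.1 hb).2.2.1

theorem isRep_ne_nil {μ : Multiplier 2} {w : List (Fin 2)} (h : μ.IsRep w) : w ≠ [] := by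
  rintro rfl
  obtain ⟨v, hv, hμ⟩ := μ.2
  have := h.trans hμ
  rw [Cycle.coe_eq_coe] at this
  exact hv.1 (by simpa using this.symm)

theorem flatten_replicate_ne_nil {w : List (Fin 2)} (hw : w ≠ []) {k : ℕ} (hk : 0 < k) :
    (List.replicate k w).flatten ≠ [] := by
  obtain ⟨k, rfl⟩ := Nat.exists_eq_succ_of_ne_zero hk.ne'
  simp [List.replicate_succ, hw]

theorem orbitsNegOf_subset_orbitsNeg (n : ℕ) (μ : Multiplier 2) :
    fibonacciDyck.orbitsNegOf n μ ⊆ fibonacciDyck.orbitsNeg n := by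
  rintro _ ⟨p, ⟨hp, i, w, k, hw, hk, h⟩, rfl⟩
  refine ⟨p, ⟨hp, i, (List.replicate k w).flatten,
    flatten_replicate_ne_nil (isRep_ne_nil hw) hk, ?_⟩, rfl⟩
  rw [h, negWord_pow]

theorem count_flatten_replicate (k : ℕ) (w : List (Fin 2)) (a : Fin 2) :
    (List.replicate k w).flatten.count a = k * w.count a := by
  simp [List.count_flatten]

theorem count_pos_of_not_single {w : List (Fin 2)} (hw : IsPrimitiveWord w) (h0 : w ≠ [0])
    (h1 : w ≠ [1]) : 0 < w.count 0 ∧ 0 < w.count 1 := by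
  have key : ∀ a : Fin 2, (∀ c ∈ w, c = a) → w = [a] := fun a h => by
    have e := List.eq_replicate_of_mem h
    have := hw.2 [a] w.length (by conv_lhs => rw [e]
                                  simp)
    rw [this] at e
    exact e
  constructor <;> rw [List.count_pos_iff] <;> by_contra h
  · exact h1 (key 1 fun c hc => by
      have : c ≠ 0 := by rintro rfl; exact h hc
      omega)
  · exact h0 (key 0 fun c hc => by
      have : c ≠ 1 := by rintro rfl; exact h hc
      omega)

theorem orbitsNegOf_subset_image {μ : Multiplier 2} {w : List (Fin 2)} (hμ : μ.IsRep w)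
    (n : ℕ) : fibonacciDyck.orbitsNegOf n μ ⊆
      orbitOf '' ⋃ k ∈ Finset.Icc 1 n, negWalks 0 [] (List.replicate k w).flatten n := by
  rintro _ ⟨p, ⟨hp, i, w', k, hw', hk, h⟩, rfl⟩
  have hrot : w' ~r w := Cycle.coe_eq_coe.1 (hw'.trans hμ.symm)
  rw [negWord_pow] at h
  obtain ⟨j, hj⟩ := exists_window_mem_negLoops hp
    (flatten_replicate_ne_nil (isRep_ne_nil hw') hk) h (IsRotated.flatten_replicate hrot k)
  -- Each unmatched letter costs at least one edge, so a loop labelled w^k has at least `k` edges.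
  have hkn : k ≤ n := by
    by_contra hlt
    have hne := flatten_replicate_ne_nil (isRep_ne_nil hμ) hk
    have hc := encard_negLoops n _ hne
    have hlen : 0 < w.length := List.length_pos_iff.2 (isRep_ne_nil hμ)
    rw [length_eq_count] at hlen
    rw [count_flatten_replicate, count_flatten_replicate, walkCoeff_eq_zero, Nat.cast_zero,
      Set.encard_eq_zero] at hc
    · rw [hc] at hj; exact hj
    · have : k * 1 ≤ k * (w.count 0 + w.count 1) := Nat.mul_le_mul_left _ hlen
      rw [mul_add] at this
      omega
  refine ⟨window p j n, ?_, orbitOf_window hp.2.1 (periodic_of_mem_periodicPts hp) j⟩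
  simp only [Set.mem_iUnion]
  exact ⟨k, Finset.mem_Icc.2 ⟨hk, hkn⟩, hj⟩

/-- `Z` consists of the orbits of blocks labelled by sorted words. These words are primitive and
pairwise non-conjugate, so `Z` is counted exactly, whereas 𝒪_n(μ₋) need only be bounded from above
by its blocks. -/
theorem exists_disjoint_orbits {μ : Multiplier 2} (h0 : μ ≠ Multiplier.single 0)
    (h1 : μ ≠ Multiplier.single 1) (n : ℕ) : ∃ Z : Set (Set (ℤ → FibEdge)),
      Z ⊆ ⋃ ν ∈ {ν : Multiplier 2 | ν ≠ μ}, fibonacciDyck.orbitsNegOf n ν ∧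
      Disjoint (fibonacciDyck.orbitsNegOf n μ) Z ∧
      (fibonacciDyck.orbitsNegOf n μ).encard ≤ Z.encard := by
  obtain ⟨w, hw, hμ⟩ := μ.2
  have hrep : μ.IsRep w := hμ.symm
  obtain ⟨hi, hj⟩ := count_pos_of_not_single hw
    (by rintro rfl; exact h0 (Subtype.ext hμ)) (by rintro rfl; exact h1 (Subtype.ext hμ))
  obtain ⟨s, hs, hle⟩ := sum_loopCount_le hi hj n
  have hcount : ∀ {x}, w ~r sortedWord x → x = (w.count 0, w.count 1) := fun {x} h => by
    have := count_sortedWord x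
    rw [← h.perm.count_eq, ← h.perm.count_eq] at this
    exact Prod.ext this.1.symm this.2.symm
  refine ⟨orbitOf '' ⋃ x ∈ s, negWalks 0 [] (sortedWord x) n, ?_, ?_, ?_⟩
  · rintro _ ⟨b, hb, rfl⟩
    simp only [Set.mem_iUnion] at hb ⊢
    obtain ⟨x, hx, hb⟩ := hb
    refine ⟨multiplierOf (hs x hx).1.isPrimitiveWord, fun h => ?_, orbitOf_mem_orbitsNegOf _ hb⟩
    refine (hs x hx).2 (hcount (Cycle.coe_eq_coe.1 ?_))
    rw [← hμ, ← h]
    rfl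
  · rw [Set.disjoint_left]
    rintro o ho ⟨c, hc, rfl⟩
    obtain ⟨b, hb, hbc⟩ := orbitsNegOf_subset_image hrep n ho
    simp only [Set.mem_iUnion] at hb hc
    obtain ⟨k, hk, hb⟩ := hb
    obtain ⟨x, hx, hc⟩ := hc
    have hrot := (isRotated_of_orbitOf_eq
      (flatten_replicate_ne_nil hw.1 (Finset.mem_Icc.1 hk).1) hb hc hbc).1
    -- A power w^k conjugate to a primitive word has k = 1, and then the letter counts would be
    -- those of `w`.
    obtain rfl := (hs x hx).1.isPrimitiveWord.eq_one_of_isRotated hrot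
    exact (hs x hx).2 (hcount (by simpa using hrot))
  · have hinj : Set.InjOn orbitOf (⋃ x ∈ s, negWalks 0 [] (sortedWord x) n) := by
      intro b hb c hc hbc
      simp only [Set.mem_iUnion] at hb hc
      obtain ⟨x, hx, hb⟩ := hb
      obtain ⟨y, hy, hc⟩ := hc
      have hprim := (hs x hx).1.isPrimitiveWord
      obtain ⟨hrot, heq⟩ := isRotated_of_orbitOf_eq hprim.1 hb hc hbc
      refine heq ?_ hprim
      have hx' := count_sortedWord x
      have hy' := count_sortedWord y
      rw [hrot.perm.count_eq, hrot.perm.count_eq] at hx'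
      rw [Prod.ext (hx'.1.symm.trans hy'.1) (hx'.2.symm.trans hy'.2)]
    rw [hinj.encard_image, encard_biUnion_eq]
    · refine (Set.encard_le_encard (orbitsNegOf_subset_image hrep n)).trans
        ((Set.encard_image_le _ _).trans ((encard_biUnion_le _ _).trans ?_))
      have e1 : ∀ k ∈ Finset.Icc 1 n,
          (negWalks 0 [] (List.replicate k w).flatten n).encard =
            (loopCount (k * w.count 0, k * w.count 1) n : ℕ∞) := fun k hk => by
        rw [encard_negLoops_eq_loopCount n
          (flatten_replicate_ne_nil hw.1 (Finset.mem_Icc.1 hk).1), count_flatten_replicate,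
          count_flatten_replicate]
      have e2 : ∀ x ∈ s, (negWalks 0 [] (sortedWord x) n).encard = (loopCount x n : ℕ∞) :=
        fun x hx => by
          rw [encard_negLoops_eq_loopCount n (hs x hx).1.isPrimitiveWord.1,
            (count_sortedWord x).1, (count_sortedWord x).2]
      rw [Finset.sum_congr rfl e1, Finset.sum_congr rfl e2]
      exact_mod_cast hle
    · exact fun x y hxy => disjoint_negWalks (Or.inr fun h => hxy (sortedWord_injective h))

/-! ### Time reversal. -/

/-- The involution of the edge set that reverses edges and exchanges signs. -/
def reverseEdge : FibEdge → FibEdge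
  | .neg0 => .pos0
  | .neg => .pos
  | .neg1 => .pos1
  | .pos0 => .neg0
  | .pos => .neg
  | .pos1 => .neg1

/-- Time reversal. -/
def timeReversal (x : ℤ → FibEdge) (i : ℤ) : FibEdge := reverseEdge (x (-i))

theorem timeReversal_timeReversal (x : ℤ → FibEdge) : timeReversal (timeReversal x) = x := by
  funext i
  simp only [timeReversal, neg_neg]
  cases x i <;> rfl

theorem window_timeReversal (x : ℤ → FibEdge) (i : ℤ) (n : ℕ) :
    window (timeReversal x) (-i - n + 1) n = ((window x i n).map reverseEdge).reverse := by
  apply List.ext_getElem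
  · simp [length_window]
  · intro j h1 h2
    rw [length_window] at h1
    simp only [window, timeReversal, List.getElem_map, List.getElem_range, List.getElem_reverse,
      List.length_map, List.length_range]
    congr 2
    omega

theorem pathLabel_reverse (b : List FibEdge) :
    fibonacciDyck.pathLabel (b.map reverseEdge).reverse = flip (fibonacciDyck.pathLabel b) := by
  rw [DyckGraph.pathLabel, DyckGraph.pathLabel, flip_prod, List.map_reverse, List.map_reverse,
    List.map_map, List.map_map]
  congr 3
  funext e
  cases e <;> rfl

theorem pathLabel_window_timeReversal (x : ℤ → FibEdge) (i : ℤ) (n : ℕ) :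
    fibonacciDyck.pathLabel (window (timeReversal x) (-i - n + 1) n) =
      flip (fibonacciDyck.pathLabel (window x i n)) := by
  rw [window_timeReversal, pathLabel_reverse]

theorem timeReversal_mem_subshift {x : ℤ → FibEdge} (hx : x ∈ fibonacciDyck.subshift) :
    timeReversal x ∈ fibonacciDyck.subshift := by
  have hp : IsBiinfinitePath (timeReversal x) := fun i => by
    have := isBiinfinitePath_of_mem hx (-(i + 1))
    rw [show -(i + 1) + 1 = -i by ring] at this
    have hs : ∀ e, fibonacciDyck.src (reverseEdge e) = fibonacciDyck.tgt e := by
      rintro (_ | _) <;> rfl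
    have ht : ∀ e, fibonacciDyck.tgt (reverseEdge e) = fibonacciDyck.src e := by
      rintro (_ | _) <;> rfl
    rw [timeReversal, timeReversal, hs, ht, this]
  refine fun i n => ⟨hp.isPath_window i n, ?_⟩
  have := pathLabel_window_timeReversal x (-i - n + 1) n
  rw [show -(-i - (n : ℤ) + 1) - n + 1 = i by ring] at this
  rw [this]
  exact flip_ne_zero (hx _ _).2

theorem timeReversal_mem_periodicPts {x : ℤ → FibEdge} {n : ℕ}
    (hx : x ∈ fibonacciDyck.periodicPts n) : timeReversal x ∈ fibonacciDyck.periodicPts n := by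
  refine ⟨timeReversal_mem_subshift hx.1, hx.2.1, ?_⟩
  rw [← hx.2.2, Function.minimalPeriod_eq_minimalPeriod_iff]
  have key : ∀ (y : ℤ → FibEdge) (m : ℤ), Function.Periodic y m →
      Function.Periodic (timeReversal y) m := fun y m h i => by
    have := h.neg (-i)
    simp only [timeReversal]
    rw [← this]
    congr 2
    ring
  intro m
  rw [isPeriodicPt_shift_iff, isPeriodicPt_shift_iff]
  exact ⟨fun h => by simpa [timeReversal_timeReversal] using key _ _ h, key _ _⟩

theorem shiftOrbit_timeReversal (x : ℤ → FibEdge) :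
    shiftOrbit (timeReversal x) = timeReversal '' shiftOrbit x := by
  ext y
  constructor
  · rintro ⟨k, rfl⟩
    refine ⟨fun i => x (i + -k), ⟨-k, rfl⟩, ?_⟩
    funext i
    simp [timeReversal, add_comm]
  · rintro ⟨_, ⟨k, rfl⟩, rfl⟩
    refine ⟨-k, ?_⟩
    funext i
    simp [timeReversal, add_comm]

theorem flip_posWord (w : List (Fin 2)) : flip (posWord w) = negWord w := by
  rw [← flip_negWord, Dyck.flip_flip]

theorem orbitsPosOf_eq_image (n : ℕ) (μ : Multiplier 2) : fibonacciDyck.orbitsPosOf n μ =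
    Set.image timeReversal '' fibonacciDyck.orbitsNegOf n μ := by
  ext o
  constructor
  · rintro ⟨p, ⟨hp, i, w, k, hw, hk, h⟩, rfl⟩
    refine ⟨_, ⟨timeReversal p, ⟨timeReversal_mem_periodicPts hp, _, w, k, hw, hk,
      (pathLabel_window_timeReversal p i n).trans ?_⟩, rfl⟩, ?_⟩
    · rw [h, flip_pow, flip_posWord]
    · rw [← shiftOrbit_timeReversal, timeReversal_timeReversal]
  · rintro ⟨_, ⟨p, ⟨hp, i, w, k, hw, hk, h⟩, rfl⟩, rfl⟩
    refine ⟨timeReversal p, ⟨timeReversal_mem_periodicPts hp, _, w, k, hw, hk,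
      (pathLabel_window_timeReversal p i n).trans ?_⟩, shiftOrbit_timeReversal p⟩
    rw [h, flip_pow, flip_negWord]

theorem orbitsPos_subset_image (n : ℕ) : fibonacciDyck.orbitsPos n ⊆
    Set.image timeReversal '' fibonacciDyck.orbitsNeg n := by
  rintro _ ⟨p, ⟨hp, i, w, hw, h⟩, rfl⟩
  refine ⟨_, ⟨timeReversal p, ⟨timeReversal_mem_periodicPts hp, _, w, hw,
    (pathLabel_window_timeReversal p i n).trans ?_⟩, rfl⟩, ?_⟩
  · rw [h, flip_posWord]
  · rw [← shiftOrbit_timeReversal, timeReversal_timeReversal]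

/-! ### Deciding which multipliers are exceptional. -/

theorem not_isExceptional {μ : Multiplier 2} (h0 : μ ≠ Multiplier.single 0)
    (h1 : μ ≠ Multiplier.single 1) : ¬ fibonacciDyck.IsExceptional μ := by
  rintro ⟨n, -, h⟩
  obtain ⟨Z, hZ, hdisj, hle⟩ := exists_disjoint_orbits h0 h1 n
  refine absurd h (not_lt.2 (le_max_of_le_left ?_))
  calc (fibonacciDyck.orbitsNegOf n μ ∪ fibonacciDyck.orbitsPosOf n μ).encard
      ≤ (fibonacciDyck.orbitsNegOf n μ).encard + (fibonacciDyck.orbitsPosOf n μ).encard :=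
        Set.encard_union_le _ _
    _ ≤ (fibonacciDyck.orbitsNegOf n μ).encard + Z.encard := by
        refine add_le_add_right ?_ _
        rw [orbitsPosOf_eq_image]
        exact (Set.encard_image_le _ _).trans hle
    _ = (fibonacciDyck.orbitsNegOf n μ ∪ Z).encard := (Set.encard_union_eq hdisj).symm
    _ ≤ (fibonacciDyck.orbitsNeg n).encard := by
        refine Set.encard_le_encard (Set.union_subset (orbitsNegOf_subset_orbitsNeg n μ) ?_)
        refine hZ.trans ?_
        simp only [Set.iUnion_subset_iff]
        exact fun ν _ => orbitsNegOf_subset_orbitsNeg n ν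

/-- A multiplier is exceptional if one of its orbits, containing no reversed edges, is the only
orbit of its length with negative multiplier. -/
theorem isExceptional_of_unique {v : List (Fin 2)} (hv : IsPrimitiveWord v) {n : ℕ}
    {b : List FibEdge} (hb : b ∈ negWalks 0 [] v n) (hneg : ∀ e ∈ b, reverseEdge e ∉ b)
    (huniq : fibonacciDyck.orbitsNeg n ⊆ {orbitOf b}) :
    fibonacciDyck.IsExceptional (multiplierOf hv) := by
  have hn := pos_of_mem_negLoops hv.1 hb
  have h1 : (fibonacciDyck.orbitsNeg n).encard ≤ 1 :=
    (Set.encard_le_encard huniq).trans (Set.encard_singleton _).le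
  have hmem := orbitOf_mem_orbitsNegOf hv hb
  have hmem' : timeReversal '' orbitOf b ∈ fibonacciDyck.orbitsPosOf n (multiplierOf hv) := by
    rw [orbitsPosOf_eq_image]; exact ⟨_, hmem, rfl⟩
  have hval : ∀ i, periodize b i ∈ b := fun i => by
    have hl : 0 < b.length := by rw [hb.1]; exact hn
    have e0 : 0 ≤ i % b.length := Int.emod_nonneg _ (by omega)
    have e1 : i % b.length < b.length := Int.emod_lt_of_pos _ (by omega)
    have e2 : (i % (b.length : ℤ)).toNat < b.length := by omega
    rw [periodize, List.getD_eq_getElem _ _ e2]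
    exact List.getElem_mem e2
  -- If the orbits coincided, the reversal of an edge of `b` would occur in `b`.
  have hne : orbitOf b ≠ timeReversal '' orbitOf b := fun h => by
    have : timeReversal (periodize b) ∈ orbitOf b := by
      rw [h]; exact ⟨_, mem_shiftOrbit_self _, rfl⟩
    obtain ⟨k, hk⟩ := this
    have h2 := congrFun hk 0
    have h3 := hval (0 + k)
    simp only [timeReversal] at h2
    rw [h2] at h3
    exact hneg _ (hval (-0)) h3
  refine ⟨n, hn, ?_⟩
  refine (max_le h1 ((Set.encard_le_encard (orbitsPos_subset_image n)).trans
    ((Set.encard_image_le _ _).trans h1))).trans_lt ?_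
  rw [Set.one_lt_encard_iff]
  exact ⟨_, _, Or.inl hmem, Or.inr hmem', hne⟩

theorem exists_window_of_mem_orbitsNeg {n : ℕ} {o : Set (ℤ → FibEdge)}
    (ho : o ∈ fibonacciDyck.orbitsNeg n) : ∃ p ∈ fibonacciDyck.periodicPts n, ∃ j v,
      v ≠ [] ∧ window p j n ∈ negWalks 0 [] v n ∧ o = orbitOf (window p j n) := by
  obtain ⟨p, ⟨hp, i, w, hw, h⟩, rfl⟩ := ho
  obtain ⟨j, hj⟩ := exists_window_mem_negLoops hp hw h (List.IsRotated.refl w)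
  exact ⟨p, hp, j, w, hw, hj, (orbitOf_window hp.2.1 (periodic_of_mem_periodicPts hp) j).symm⟩

theorem isExceptional_single_zero : fibonacciDyck.IsExceptional (Multiplier.single 0) := by
  refine isExceptional_of_unique (v := [0]) (isPrimitiveWord_singleton 0) (n := 1)
    (b := [.neg0]) ?_ (by decide) ?_
  · exact mem_negLoops_iff.2 ⟨rfl, ⟨rfl, rfl⟩, rfl, by simp⟩
  · intro o ho
    obtain ⟨p, hp, j, v, hv, hj, rfl⟩ := exists_window_of_mem_orbitsNeg ho
    rw [window_one] at hj ⊢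
    obtain ⟨-, hwalk, -, hlast⟩ := hj
    rcases hlast (p j) (by simp) with h | h
    · rw [h]; rfl
    · rw [h] at hwalk
      exact absurd hwalk.1 (by decide)

theorem isExceptional_single_one : fibonacciDyck.IsExceptional (Multiplier.single 1) := by
  refine isExceptional_of_unique (v := [1]) (isPrimitiveWord_singleton 1) (n := 2)
    (b := [.neg, .neg1]) ?_ (by decide) ?_
  · exact mem_negLoops_iff.2 ⟨rfl, ⟨rfl, rfl, rfl⟩, rfl, by simp⟩
  · intro o ho
    obtain ⟨p, hp, j, v, hv, hj, rfl⟩ := exists_window_of_mem_orbitsNeg ho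
    have hper := periodic_of_mem_periodicPts hp
    -- This block would make `p` a fixed point, against least period 2.
    have hne : ¬ (p j = .neg0 ∧ p (j + 1) = .neg0) := fun h => by
      have hall : ∀ i, p i = .neg0 := fun i => by
        rcases Int.even_or_odd' (i - j) with ⟨q, hq | hq⟩
        · rw [show i = j + q • ((2 : ℕ) : ℤ) by simp; omega, hper.zsmul q, h.1]
        · rw [show i = j + 1 + q • ((2 : ℕ) : ℤ) by simp; omega, hper.zsmul q, h.2]
      have h1 : Function.IsPeriodicPt shift 1 p :=
        (isPeriodicPt_shift_iff _ _).2 fun i => by rw [hall, hall]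
      have := h1.minimalPeriod_le one_pos
      rw [hp.2.2] at this
      omega
    rw [window_succ, window_one] at hj ⊢
    obtain ⟨-, hwalk, hlab, hlast⟩ := mem_negLoops_iff.1 hj
    -- The first edge is a left factor of a negative label, so it cannot be positive; adjacency of
    -- edges then leaves only β⁻ β⁻(1).
    obtain ⟨w, hw⟩ := eq_negWord_of_mul_eq ((pathLabel_cons _ _).symm.trans hlab)
    obtain ⟨hs, hs', -⟩ := hwalk
    replace hlast := hlast (p (j + 1)) (by simp)
    generalize p j = e at *
    generalize p (j + 1) = f at *
    have hpos : ∀ m, pos m ≠ negWord w := fun m h => by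
      rw [negWord_eq_word, pos] at h
      simp at h
    rcases hlast with rfl | rfl <;> cases e
    · exact (hne ⟨rfl, rfl⟩).elim
    · exact absurd hs' (by decide)
    · exact absurd hs (by decide)
    · exact (hpos _ hw).elim
    · exact absurd hs (by decide)
    · exact absurd hs' (by decide)
    · exact absurd hs' (by decide)
    · rfl
    · exact absurd hs (by decide)
    · exact absurd hs' (by decide)
    · exact absurd hs (by decide)
    · exact (hpos _ hw).elim

end FibDyck

theorem lemma2 :
    (∀ μ : Multiplier 2,
      fibonacciDyck.IsExceptional μ ↔ μ = Multiplier.single 0 ∨ μ = Multiplier.single 1) ∧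
    ∀ μ : Multiplier 2, μ ≠ Multiplier.single 0 → μ ≠ Multiplier.single 1 →
      ∀ n : ℕ, 0 < n →
        (fibonacciDyck.orbitsNegOf n μ).encard ≤
          (⋃ ν ∈ {ν : Multiplier 2 | ν ≠ μ}, fibonacciDyck.orbitsNegOf n ν).encard := by
  refine ⟨fun μ => ⟨fun h => ?_, ?_⟩, fun μ h0 h1 n _ => ?_⟩
  · by_contra! hne
    exact FibDyck.not_isExceptional hne.1 hne.2 h
  · rintro (rfl | rfl)
    · exact FibDyck.isExceptional_single_zero
    · exact FibDyck.isExceptional_single_one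
  · obtain ⟨Z, hZ, -, hle⟩ := FibDyck.exists_disjoint_orbits h0 h1 n
    exact hle.trans (Set.encard_le_encard hZ)
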